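/- Let $\sigma\subseteq\mathbb{R}\setminus\{0\}$ be a (finite or infinite, automatically discrete) set with $\sum_{\lambda\in\sigma}\frac{1}{|\lambda|}<\infty$, and let $$W(z)=\prod_{\lambda\in\sigma}\Bigl(1-\frac{z}{\lambda}\Bigr),\qquad z\in\mathbb{C}.$$ Given coupling constants $\eta_\lambda\in\mathbb{R}\cup\{\infty\}$, $\lambda\in\sigma$, a solution of the coupling problem with data $\{\eta_\lambda\}_{\lambda\in\sigma}$ is a pair $(\Phi_-,\Phi_+)$ of entire functions of exponential type zero (that is, for every $\varepsilon>0$ there is a constant $C$ with $|\Phi_\pm(z)|\le C e^{\varepsilon|z|}$ for all $z\in\mathbb{C}$) such that - (C) $\Phi_+(\lambda)=\eta_\lambda\Phi_-(\lambda)$ for all $\lambda\in\sigma$, to be read as $\Phi_-(\lambda)=0$ if $\eta_\lambda=\infty$; - (G) $\operatorname{Im}\left(\dfrac{z\,\Phi_-(z)\Phi_+(z)}{W(z)}\right)\ge 0$ whenever $\operatorname{Im}(z)>0$; - (N) $\Phi_-(0)=\Phi_+(0)=1$. Let $\Delta$ be a first-countable topological space, let $\delta_\infty\in\Delta$, and for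 every $\delta\in\Delta$ let coupling constants $\eta_\lambda(\delta)\in\mathbb{R}\cup\{\infty\}$, $\lambda\in\sigma$, be given. Suppose that for every $\lambda\in\sigma$ $$\bigl|\ln|\eta_\lambda(\delta)|\bigr|\to\infty\quad\text{as }\delta\to\delta_\infty,\ \delta\neq\delta_\infty,$$ where $|\ln|c||=\infty$ for $c=0$ and $c=\infty$. If for every $\delta\in\Delta$ the pair $(\Phi_-(\,\cdot\,,\delta),\Phi_+(\,\cdot\,,\delta))$ is a solution of the coupling problem with data $\{\eta_\lambda(\delta)\}_{\lambda\in\sigma}$, then $$\frac{\Phi_-(z,\delta)\,\Phi_+(z,\delta)}{W(z)}\to 1\quad\text{as }\delta\to\delta_\infty,\ \delta\neq\delta_\infty,$$ locally uniformly for $z\in\mathbb{C}\setminus\sigma$. -/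

import Mathlib

open Filter Topology

noncomputable section

namespace EntireCoupling

/-- The infinite product `W(z) = ∏_{s ∈ σ} (1 - z / s)`. -/
def W (σ : Set ℝ) (z : ℂ) : ℂ := ∏' s : σ, (1 - z / ((s : ℝ) : ℂ))

/-- An entire function of exponential type zero: for every `ε > 0` it is bounded by a constant
multiple of `exp (ε |z|)`. -/
def IsEntireOfTypeZero (f : ℂ → ℂ) : Prop :=
  Differentiable ℂ f ∧ ∀ ε : ℝ, 0 < ε → ∃ C : ℝ, ∀ z : ℂ, ‖f z‖ ≤ C * Real.exp (ε * ‖z‖)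

/-- `(Φm, Φp) = (Φ₋, Φ₊)` is a solution of the coupling problem with data `η` on `σ`. The coupling
constants lie in `ℝ ∪ {∞} = OnePoint ℝ`. -/
structure IsSolution (σ : Set ℝ) (η : σ → OnePoint ℝ) (Φm Φp : ℂ → ℂ) : Prop where
  entire_m : IsEntireOfTypeZero Φm
  entire_p : IsEntireOfTypeZero Φp
  /-- coupling condition, finite coupling constants -/
  coupling : ∀ (s : σ) (c : ℝ), η s = (c : OnePoint ℝ) →
    Φp ((s : ℝ) : ℂ) = (c : ℂ) * Φm ((s : ℝ) : ℂ)
  /-- coupling condition, infinite coupling constants -/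
  coupling_infty : ∀ s : σ, η s = OnePoint.infty → Φm ((s : ℝ) : ℂ) = 0
  /-- growth and positivity condition -/
  positivity : ∀ z : ℂ, 0 < z.im → 0 ≤ (z * Φm z * Φp z / W σ z).im
  /-- normalization condition -/
  normalization_m : Φm 0 = 1
  normalization_p : Φp 0 = 1

/-- The modulus `|c| ∈ [0, ∞]` of `c ∈ ℝ ∪ {∞}`, with `|∞| = ∞`. -/
def modulus : OnePoint ℝ → ENNReal
  | none => ⊤
  | some c => ENNReal.ofReal |c|

/-- `|ln |c|| ∈ [0, ∞]` for `c ∈ ℝ ∪ {∞}`; the value is `∞` at `c = 0` and at `c = ∞`. -/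
def absLogAbs (c : OnePoint ℝ) : ENNReal := (ENNReal.log (modulus c)).abs

end EntireCoupling

end

namespace EntireCoupling

open Complex Metric Set ComplexConjugate

/-! ### Growth conditions -/

/-- `f` has minimal exponential growth on `s`. -/
def SubexpOn (s : Set ℂ) (f : ℂ → ℂ) : Prop :=
  ∀ ε : ℝ, 0 < ε → ∃ C : ℝ, ∀ z ∈ s, ‖f z‖ ≤ C * Real.exp (ε * ‖z‖)

/-- `f` has growth of order at most `3 / 2` on `s`. -/
def OrderOn (s : Set ℂ) (f : ℂ → ℂ) : Prop :=
  ∃ B : ℝ, ∀ z ∈ s, ‖f z‖ ≤ Real.exp (B * (1 + ‖z‖) ^ (3 / 2 : ℝ))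

theorem one_add_le_rpow {r : ℝ} (hr : 0 ≤ r) : 1 + r ≤ (1 + r) ^ (3 / 2 : ℝ) := by
  simpa using Real.rpow_le_rpow_of_exponent_le (x := 1 + r) (by linarith)
    (by norm_num : (1 : ℝ) ≤ 3 / 2)

theorem SubexpOn.exists_pos {s : Set ℂ} {f : ℂ → ℂ} (hf : SubexpOn s f) {ε : ℝ} (hε : 0 < ε) :
    ∃ C : ℝ, 0 < C ∧ ∀ z ∈ s, ‖f z‖ ≤ C * Real.exp (ε * ‖z‖) := by
  obtain ⟨C, hC⟩ := hf ε hε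
  refine ⟨max C 1, by positivity, fun z hz => (hC z hz).trans ?_⟩
  gcongr
  exact le_max_left _ _

theorem SubexpOn.mul {s : Set ℂ} {f g : ℂ → ℂ} (hf : SubexpOn s f) (hg : SubexpOn s g) :
    SubexpOn s (fun z => f z * g z) := by
  intro ε hε
  obtain ⟨C, hC0, hC⟩ := hf.exists_pos (half_pos hε)
  obtain ⟨D, hD0, hD⟩ := hg.exists_pos (half_pos hε)
  refine ⟨C * D, fun z hz => ?_⟩
  rw [norm_mul]
  calc ‖f z‖ * ‖g z‖ ≤ (C * Real.exp (ε / 2 * ‖z‖)) * (D * Real.exp (ε / 2 * ‖z‖)) := by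
        gcongr
        exacts [hC z hz, hD z hz]
    _ = C * D * (Real.exp (ε / 2 * ‖z‖) * Real.exp (ε / 2 * ‖z‖)) := by ring
    _ = C * D * Real.exp (ε * ‖z‖) := by rw [← Real.exp_add]; ring_nf

theorem SubexpOn.mono {s t : Set ℂ} {f g : ℂ → ℂ} (hf : SubexpOn s f) (hts : t ⊆ s)
    (hgf : ∀ z ∈ t, ‖g z‖ ≤ ‖f z‖) : SubexpOn t g := fun ε hε =>
  (hf ε hε).imp fun _ hC z hz => (hgf z hz).trans (hC z (hts hz))

theorem SubexpOn.comp {s t : Set ℂ} {f g : ℂ → ℂ} {K : ℝ} (hf : SubexpOn s f)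
    (hg : ∀ z ∈ t, g z ∈ s) (hK : ∀ z ∈ t, ‖g z‖ ≤ ‖z‖ + K) : SubexpOn t (fun z => f (g z)) := by
  intro ε hε
  obtain ⟨C, hC0, hC⟩ := hf.exists_pos hε
  refine ⟨C * Real.exp (ε * K), fun z hz => (hC _ (hg z hz)).trans ?_⟩
  rw [mul_assoc, ← Real.exp_add]
  gcongr
  nlinarith [hK z hz]

theorem subexpOn_const (s : Set ℂ) (c : ℂ) : SubexpOn s (fun _ => c) := fun ε hε =>
  ⟨‖c‖, fun z _ => le_mul_of_one_le_right (norm_nonneg _) (Real.one_le_exp (by positivity))⟩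

theorem subexpOn_one_add_norm (s : Set ℂ) : SubexpOn s (fun z => ((1 + ‖z‖ : ℝ) : ℂ)) := by
  intro ε hε
  refine ⟨1 + 1 / ε, fun z _ => ?_⟩
  rw [norm_real, Real.norm_of_nonneg (by positivity)]
  have h1 := Real.add_one_le_exp (ε * ‖z‖)
  have h2 : 1 ≤ Real.exp (ε * ‖z‖) := Real.one_le_exp (by positivity)
  have h3 : ‖z‖ ≤ 1 / ε * Real.exp (ε * ‖z‖) := by
    rw [div_mul_eq_mul_div, one_mul, le_div_iff₀ hε]
    linarith
  linarith

theorem SubexpOn.orderOn {s : Set ℂ} {f : ℂ → ℂ} (hf : SubexpOn s f) : OrderOn s f := by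
  obtain ⟨C, hC0, hC⟩ := hf.exists_pos one_pos
  refine ⟨C + 1, fun z hz => (hC z hz).trans ?_⟩
  have h1 : C ≤ Real.exp C := by linarith [Real.add_one_le_exp C]
  calc C * Real.exp (1 * ‖z‖) ≤ Real.exp C * Real.exp (1 * ‖z‖) := by gcongr
    _ = Real.exp (C + ‖z‖) := by rw [← Real.exp_add, one_mul]
    _ ≤ _ := by
      gcongr
      have := one_add_le_rpow (norm_nonneg z)
      nlinarith [norm_nonneg z]

theorem OrderOn.mul {s : Set ℂ} {f g : ℂ → ℂ} (hf : OrderOn s f) (hg : OrderOn s g) :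
    OrderOn s (fun z => f z * g z) := by
  obtain ⟨B, hB⟩ := hf
  obtain ⟨D, hD⟩ := hg
  refine ⟨B + D, fun z hz => ?_⟩
  rw [norm_mul, add_mul, Real.exp_add]
  gcongr
  exacts [hB z hz, hD z hz]

theorem OrderOn.mono {s t : Set ℂ} {f g : ℂ → ℂ} (hf : OrderOn s f) (hts : t ⊆ s)
    (hgf : ∀ z ∈ t, ‖g z‖ ≤ ‖f z‖) : OrderOn t g :=
  hf.imp fun _ hC z hz => (hgf z hz).trans (hC z (hts hz))

theorem OrderOn.comp {s t : Set ℂ} {f g : ℂ → ℂ} {K : ℝ} (hf : OrderOn s f) (hK0 : 0 ≤ K)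
    (hg : ∀ z ∈ t, g z ∈ s) (hK : ∀ z ∈ t, ‖g z‖ ≤ ‖z‖ + K) : OrderOn t (fun z => f (g z)) := by
  obtain ⟨B, hB⟩ := hf
  refine ⟨|B| * (1 + K) ^ (3 / 2 : ℝ), fun z hz => (hB _ (hg z hz)).trans ?_⟩
  rw [mul_assoc, ← Real.mul_rpow (by positivity) (by positivity)]
  gcongr
  · exact le_abs_self B
  · nlinarith [hK z hz, norm_nonneg z]

/-- The **Phragmén–Lindelöf principle** in the right half-plane, for functions of minimal growth
on the positive real axis. -/
theorem norm_le_of_subexpOn_ray {f : ℂ → ℂ} {C : ℝ} (hd : DiffContOnCl ℂ f {z | 0 < z.re})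
    (hexp : OrderOn {z | 0 < z.re} f)
    (hre : SubexpOn {z | 0 ≤ z.re ∧ z.im = 0} f)
    (him : ∀ x : ℝ, ‖f (x * I)‖ ≤ C) {z : ℂ} (hz : 0 ≤ z.re) : ‖f z‖ ≤ C := by
  -- The factor `exp(-εz)` makes the function bounded on the positive ray, has modulus one on the
  -- imaginary axis, and tends to one as `ε → 0`. The classical principle allows any order below 2,
  -- hence the exponent `3 / 2`.
  have key : ∀ ε : ℝ, 0 < ε → ‖cexp (-(ε : ℂ) * z) * f z‖ ≤ C := by
    intro ε hε
    have hn : ∀ w : ℂ, ‖cexp (-(ε : ℂ) * w)‖ = Real.exp (-ε * w.re) := by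
      intro w
      rw [norm_exp]
      simp
    refine PhragmenLindelof.right_half_plane_of_bounded_on_real
      (f := fun w => cexp (-(ε : ℂ) * w) * f w) ?_ ?_ ?_ ?_ hz
    · exact ((differentiable_id.const_mul _).cexp.diffContOnCl).smul hd
    · obtain ⟨B, hB⟩ := hexp
      refine ⟨3 / 2, by norm_num, |B| * 2 ^ (3 / 2 : ℝ), Asymptotics.IsBigO.of_bound 1 ?_⟩
      rw [eventually_inf_principal]
      filter_upwards [eventually_cobounded_le_norm (E := ℂ) 1] with w hw hwre
      rw [norm_mul, hn, one_mul, Real.norm_of_nonneg (Real.exp_pos _).le, mul_assoc,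
        ← Real.mul_rpow (by positivity) (by positivity)]
      have h1 : Real.exp (-ε * w.re) ≤ 1 := by
        rw [Real.exp_le_one_iff]
        have : 0 < w.re := hwre
        nlinarith
      refine (mul_le_of_le_one_left (norm_nonneg _) h1).trans ((hB w hwre).trans ?_)
      gcongr
      · exact le_abs_self B
      · linarith
    · obtain ⟨A, hA⟩ := hre ε hε
      refine ⟨A, ?_⟩
      rw [eventually_map]
      filter_upwards [eventually_ge_atTop 0] with x hx
      rw [norm_mul, hn, ofReal_re, neg_mul, Real.exp_neg, inv_mul_le_iff₀ (Real.exp_pos _)]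
      have := hA x (by simpa using hx)
      rw [norm_real, Real.norm_of_nonneg hx] at this
      linarith
    · intro x
      rw [norm_mul, hn]
      simpa using him x
  have hlim : Tendsto (fun ε : ℝ => ‖cexp (-(ε : ℂ) * z) * f z‖) (𝓝[>] 0) (𝓝 ‖f z‖) := by
    refine Tendsto.mono_left ?_ nhdsWithin_le_nhds
    exact Continuous.tendsto' (by fun_prop) _ _ (by simp)
  exact le_of_tendsto hlim (by filter_upwards [self_mem_nhdsWithin] with ε hε using key ε hε)

/-! ### Locally bounded families of entire functions -/

/-- Cauchy's estimate makes a locally bounded family locally equi-Lipschitz, which upgrades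
pointwise to locally uniform convergence. -/
theorem tendstoLocallyUniformly_of_locallyBounded {ι : Type*} {l : Filter ι} [l.NeBot]
    {F : ι → ℂ → ℂ} {g : ℂ → ℂ} (hF : ∀ i, Differentiable ℂ (F i))
    (hb : ∀ R : ℝ, ∃ B : ℝ, ∀ i z, ‖z‖ ≤ R → ‖F i z‖ ≤ B)
    (hlim : ∀ z, Tendsto (fun i => F i z) l (𝓝 (g z))) :
    TendstoLocallyUniformly F g l := by
  rw [Metric.tendstoLocallyUniformly_iff]
  intro ε hε x
  -- One unit of radius for the ball around `x`, one for the Cauchy circles about its points.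
  obtain ⟨B, hB⟩ := hb (‖x‖ + 2)
  have hlip : ∀ i, ∀ y ∈ ball x 1, ‖F i y - F i x‖ ≤ (|B| + 1) * ‖y - x‖ := by
    intro i y hy
    refine (convex_ball x 1).norm_image_sub_le_of_norm_deriv_le (𝕜 := ℂ)
      (fun w _ => hF i w) (fun w hw => ?_) (mem_ball_self one_pos) hy
    have h := norm_deriv_le_of_forall_mem_sphere_norm_le (c := w) (R := 1) (C := |B| + 1)
      one_pos (hF i).diffContOnCl (fun v hv => (hB i v ?_).trans (by linarith [le_abs_self B]))
    · simpa using h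
    · have h1 : ‖v - w‖ = 1 := by simpa [dist_eq_norm] using hv
      have h2 : ‖w - x‖ < 1 := by simpa [dist_eq_norm] using hw
      calc ‖v‖ = ‖(v - w) + (w - x) + x‖ := by congr 1; ring
        _ ≤ ‖v - w‖ + ‖w - x‖ + ‖x‖ := norm_add₃_le
        _ ≤ _ := by linarith
  have hlipg : ∀ y ∈ ball x 1, ‖g y - g x‖ ≤ (|B| + 1) * ‖y - x‖ := fun y hy =>
    le_of_tendsto ((hlim y).sub (hlim x)).norm (Eventually.of_forall fun i => hlip i y hy)
  set r : ℝ := min 1 (ε / (3 * (|B| + 1))) with hr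
  have hr0 : 0 < r := by positivity
  refine ⟨ball x r, ball_mem_nhds x hr0, ?_⟩
  have h0 := (Metric.tendsto_nhds.1 (hlim x)) (ε / 3) (by positivity)
  filter_upwards [h0] with i hi y hy
  have hy1 : y ∈ ball x 1 := ball_subset_ball (min_le_left _ _) hy
  have hyr : (|B| + 1) * ‖y - x‖ ≤ ε / 3 := by
    have h3 : ‖y - x‖ ≤ ε / (3 * (|B| + 1)) := by
      have : ‖y - x‖ < r := by simpa [dist_eq_norm] using hy
      exact this.le.trans (min_le_right _ _)
    calc (|B| + 1) * ‖y - x‖ ≤ (|B| + 1) * (ε / (3 * (|B| + 1))) := by gcongr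
      _ = ε / 3 := by field_simp
  have ha := hlip i y hy1
  have hb' := hlipg y hy1
  rw [dist_eq_norm] at hi ⊢
  calc ‖g y - F i y‖ = ‖(g y - g x) - (F i x - g x) - (F i y - F i x)‖ := by congr 1; ring
    _ ≤ ‖g y - g x‖ + ‖F i x - g x‖ + ‖F i y - F i x‖ :=
      (norm_sub_le _ _).trans (add_le_add_left (norm_sub_le _ _) _)
    _ < ε := by linarith

theorem differentiable_of_tendstoLocallyUniformly {ι : Type*} {l : Filter ι} [l.NeBot]
    {F : ι → ℂ → ℂ} {g : ℂ → ℂ} (hF : ∀ i, Differentiable ℂ (F i))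
    (h : TendstoLocallyUniformly F g l) : Differentiable ℂ g := by
  rw [← differentiableOn_univ]
  exact (tendstoLocallyUniformlyOn_univ.2 h).differentiableOn
    (Eventually.of_forall fun i => (hF i).differentiableOn) isOpen_univ

/-- **Montel's theorem** for entire functions, in terms of ultrafilters. -/
theorem exists_tendstoLocallyUniformly_ultrafilter {ι : Type*} (l : Ultrafilter ι)
    {F : ι → ℂ → ℂ} (hF : ∀ i, Differentiable ℂ (F i))
    (hb : ∀ R : ℝ, ∃ B : ℝ, ∀ i z, ‖z‖ ≤ R → ‖F i z‖ ≤ B) :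
    ∃ g : ℂ → ℂ, Differentiable ℂ g ∧ TendstoLocallyUniformly F g l := by
  have hpt : ∀ z, ∃ c, Tendsto (fun i => F i z) l (𝓝 c) := by
    intro z
    obtain ⟨B, hB⟩ := hb ‖z‖
    obtain ⟨c, -, hc⟩ := (isCompact_closedBall (0 : ℂ) B).ultrafilter_le_nhds
      (l.map fun i => F i z) (by
        rw [le_principal_iff]
        exact Filter.mem_map.2 (Eventually.of_forall fun i => by simpa using hB i z le_rfl))
    exact ⟨c, hc⟩
  choose g hg using hpt
  have h := tendstoLocallyUniformly_of_locallyBounded hF hb hg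
  exact ⟨g, differentiable_of_tendstoLocallyUniformly hF h, h⟩

/-! ### The Schwarz–Pick lemma in the upper half-plane -/

theorem normSq_sub_conj (a b : ℂ) : ‖a - b‖ ^ 2 = ‖a - conj b‖ ^ 2 - 4 * a.im * b.im := by
  rw [← normSq_eq_norm_sq, ← normSq_eq_norm_sq, normSq_apply, normSq_apply]
  simp
  ring

theorem sub_conj_ne_zero {a b : ℂ} (ha : 0 < a.im) (hb : 0 < b.im) : a - conj b ≠ 0 := by
  intro h
  have := congrArg im h
  simp at this
  linarith

/-- Cayley transforms turn `M` into a self-map `g` of the disc fixing `0`, to which Schwarz's lemma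
applies; `T` sends the disc to the half-plane and `0` to `w`. The inequality is cleared of
denominators, so that it still makes sense when `Im M` vanishes. -/
theorem schwarzPick_of_pos {M : ℂ → ℂ} (hd : DifferentiableOn ℂ M {z | 0 < z.im})
    (hM : ∀ z : ℂ, 0 < z.im → 0 < (M z).im) {z w : ℂ} (hz : 0 < z.im) (hw : 0 < w.im) :
    z.im * w.im * ‖M z - conj (M w)‖ ^ 2 ≤ (M z).im * (M w).im * ‖z - conj w‖ ^ 2 := by
  set T : ℂ → ℂ := fun ζ => (w - conj w * ζ) / (1 - ζ) with hT
  have hne : ∀ ζ ∈ ball (0 : ℂ) 1, 1 - ζ ≠ 0 := by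
    intro ζ hζ h
    have h1 : ζ = 1 := by linear_combination -h
    simp [h1] at hζ
  have hTim : ∀ ζ ∈ ball (0 : ℂ) 1, 0 < (T ζ).im := by
    intro ζ hζ
    have h1 := hne ζ hζ
    have h2 : (T ζ).im = w.im * (1 - normSq ζ) / normSq (1 - ζ) := by
      have h3 : normSq (1 - ζ) ≠ 0 := by simpa using h1
      simp only [hT, div_im]
      field_simp
      simp [normSq_apply]
      ring
    have h4 : normSq ζ < 1 := by
      rw [normSq_eq_norm_sq]
      have : ‖ζ‖ < 1 := by simpa using hζ
      nlinarith [norm_nonneg ζ]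
    have h5 : 0 < normSq (1 - ζ) := normSq_pos.2 h1
    rw [h2]
    have : 0 < 1 - normSq ζ := by linarith
    positivity
  set g : ℂ → ℂ := fun ζ => (M (T ζ) - M w) / (M (T ζ) - conj (M w)) with hg
  have hTd : DifferentiableOn ℂ T (ball 0 1) := fun ζ hζ =>
    (DifferentiableAt.div (by fun_prop) (by fun_prop) (hne ζ hζ)).differentiableWithinAt
  have hMT : DifferentiableOn ℂ (fun ζ => M (T ζ)) (ball 0 1) := hd.comp hTd hTim
  have hgd : DifferentiableOn ℂ g (ball 0 1) :=
    (hMT.sub_const _).div (hMT.sub_const _)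
      fun ζ hζ => sub_conj_ne_zero (hM _ (hTim ζ hζ)) (hM w hw)
  have hgm : MapsTo g (ball 0 1) (closedBall 0 1) := by
    intro ζ hζ
    have h1 := hM _ (hTim ζ hζ)
    have h2 := hM w hw
    have h3 : 0 < ‖M (T ζ) - conj (M w)‖ := norm_pos_iff.2 (sub_conj_ne_zero h1 h2)
    rw [mem_closedBall_zero_iff, hg, norm_div, div_le_one h3]
    refine le_of_sq_le_sq ?_ h3.le
    rw [normSq_sub_conj]
    nlinarith [mul_pos h1 h2]
  have hg0 : g 0 = 0 := by simp [hg, hT]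
  have hζ : ‖(z - w) / (z - conj w)‖ < 1 := by
    have h3 : 0 < ‖z - conj w‖ := norm_pos_iff.2 (sub_conj_ne_zero hz hw)
    rw [norm_div, div_lt_one h3]
    refine lt_of_pow_lt_pow_left₀ 2 h3.le ?_
    rw [normSq_sub_conj]
    nlinarith [mul_pos hz hw]
  have hTζ : T ((z - w) / (z - conj w)) = z := by
    have h1 := sub_conj_ne_zero hz hw
    have h2 := sub_conj_ne_zero hw hw
    have h3 : 1 - (z - w) / (z - conj w) = (w - conj w) / (z - conj w) := by
      field_simp
      ring
    simp only [hT]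
    rw [h3, div_eq_iff (div_ne_zero h2 h1)]
    field_simp
    ring
  have key := norm_le_norm_of_mapsTo_ball hgd hgm hg0 hζ
  have h1 : 0 < ‖M z - conj (M w)‖ := norm_pos_iff.2 (sub_conj_ne_zero (hM z hz) (hM w hw))
  have h2 : 0 < ‖z - conj w‖ := norm_pos_iff.2 (sub_conj_ne_zero hz hw)
  simp only [hg, hTζ, norm_div] at key
  rw [div_le_div_iff₀ h1 h2] at key
  have h3 := pow_le_pow_left₀ (by positivity) key 2
  rw [mul_pow, mul_pow, normSq_sub_conj (M z) (M w), normSq_sub_conj z w] at h3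
  nlinarith

/-- The **Schwarz–Pick lemma** for maps of the upper half-plane into its closure. -/
theorem schwarzPick {M : ℂ → ℂ} (hd : DifferentiableOn ℂ M {z | 0 < z.im})
    (hM : ∀ z : ℂ, 0 < z.im → 0 ≤ (M z).im) {z w : ℂ} (hz : 0 < z.im) (hw : 0 < w.im) :
    z.im * w.im * ‖M z - conj (M w)‖ ^ 2 ≤ (M z).im * (M w).im * ‖z - conj w‖ ^ 2 := by
  have key : ∀ τ : ℝ, 0 < τ →
      z.im * w.im * ‖(M z + τ * I) - conj (M w + τ * I)‖ ^ 2 ≤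
        (M z + τ * I).im * (M w + τ * I).im * ‖z - conj w‖ ^ 2 := fun τ hτ =>
    schwarzPick_of_pos (M := fun z => M z + τ * I) (hd.add_const _)
      (fun z hz => by simpa using add_pos_of_nonneg_of_pos (hM z hz) hτ) hz hw
  have hL : Tendsto (fun τ : ℝ => z.im * w.im * ‖(M z + τ * I) - conj (M w + τ * I)‖ ^ 2)
      (𝓝[>] 0) (𝓝 (z.im * w.im * ‖M z - conj (M w)‖ ^ 2)) := by
    refine Tendsto.mono_left (Continuous.tendsto' ?_ _ _ (by simp)) nhdsWithin_le_nhds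
    fun_prop
  have hR : Tendsto (fun τ : ℝ => (M z + τ * I).im * (M w + τ * I).im * ‖z - conj w‖ ^ 2)
      (𝓝[>] 0) (𝓝 ((M z).im * (M w).im * ‖z - conj w‖ ^ 2)) := by
    refine Tendsto.mono_left (Continuous.tendsto' ?_ _ _ (by simp)) nhdsWithin_le_nhds
    fun_prop
  exact le_of_tendsto_of_tendsto hL hR
    (by filter_upwards [self_mem_nhdsWithin] with τ hτ using key τ hτ)

/-! ### Canonical products of genus zero -/

section CanonicalProduct

variable {ι : Type*}

/-- The canonical product `∏ (1 - aᵢ z)`. -/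
noncomputable def canonicalProduct (a : ι → ℂ) (z : ℂ) : ℂ := ∏' i, (1 - a i * z)

variable {a : ι → ℂ}

theorem hasProd_canonicalProduct (ha : Summable fun i => ‖a i‖) (z : ℂ) :
    HasProd (fun i => 1 - a i * z) (canonicalProduct a z) := by
  have h : Multipliable fun i => 1 + -(a i * z) :=
    multipliable_one_add_of_summable (by simpa [norm_mul] using ha.mul_right ‖z‖)
  simp only [← sub_eq_add_neg] at h
  exact h.hasProd

theorem canonicalProduct_zero : canonicalProduct a 0 = 1 := by simp [canonicalProduct]

theorem one_le_prod_of_one_le {s : Finset ι} {f : ι → ℝ} (hf : ∀ i ∈ s, 1 ≤ f i) :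
    1 ≤ ∏ i ∈ s, f i := by
  simpa using Finset.prod_le_prod (s := s) (f := fun _ => (1 : ℝ)) (fun _ _ => zero_le_one) hf

theorem norm_one_sub_le_exp (b z : ℂ) : ‖1 - b * z‖ ≤ Real.exp (‖b‖ * ‖z‖) := by
  have h1 : ‖1 - b * z‖ ≤ 1 + ‖b‖ * ‖z‖ := by
    simpa [norm_mul] using norm_sub_le (1 : ℂ) (b * z)
  linarith [Real.add_one_le_exp (‖b‖ * ‖z‖)]

theorem norm_prod_le_exp (ha : Summable fun i => ‖a i‖) (s : Finset ι) (z : ℂ) :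
    ‖∏ i ∈ s, (1 - a i * z)‖ ≤ Real.exp ((∑' i, ‖a i‖) * ‖z‖) := by
  rw [norm_prod]
  calc ∏ i ∈ s, ‖1 - a i * z‖ ≤ ∏ i ∈ s, Real.exp (‖a i‖ * ‖z‖) := by
        gcongr with i _
        exact norm_one_sub_le_exp _ _
    _ = Real.exp ((∑ i ∈ s, ‖a i‖) * ‖z‖) := by rw [← Real.exp_sum, Finset.sum_mul]
    _ ≤ _ := by
        gcongr
        exact ha.sum_le_tsum s fun i _ => norm_nonneg _

theorem differentiable_canonicalProduct (ha : Summable fun i => ‖a i‖) :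
    Differentiable ℂ (canonicalProduct a) := by
  have hF : ∀ s : Finset ι, Differentiable ℂ fun z => ∏ i ∈ s, (1 - a i * z) := fun s => by
    fun_prop
  refine differentiable_of_tendstoLocallyUniformly (l := atTop) hF
    (tendstoLocallyUniformly_of_locallyBounded hF (fun R => ?_) (hasProd_canonicalProduct ha))
  refine ⟨Real.exp ((∑' i, ‖a i‖) * R), fun s z hz => (norm_prod_le_exp ha s z).trans ?_⟩
  gcongr

theorem subexpOn_canonicalProduct (ha : Summable fun i => ‖a i‖) :
    SubexpOn univ (canonicalProduct a) := by
  intro ε hε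
  set A := ∑' i, ‖a i‖ with hA
  have hA0 : 0 ≤ A := tsum_nonneg fun i => norm_nonneg _
  obtain ⟨s, hs⟩ := ((Tendsto.eventually_const_lt (by linarith : A - ε / 2 < A)
    ha.hasSum) : ∀ᶠ s : Finset ι in atTop, A - ε / 2 < ∑ i ∈ s, ‖a i‖).exists_forall_of_atTop
  -- The finitely many factors in `s` satisfy `κ(1 + x) ≤ 1 + κx ≤ exp(κx)`: their exponential rate
  -- can be made small at the price of a constant `κ⁻¹` each. The remaining factors contribute rate
  -- at most `ε / 2`.
  set κ : ℝ := min 1 (ε / (2 * (A + 1))) with hκ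
  have hκ0 : 0 < κ := by positivity
  have hκ1 : κ ≤ 1 := min_le_left _ _
  have hκA : κ * A ≤ ε / 2 := by
    calc κ * A ≤ ε / (2 * (A + 1)) * (A + 1) := by
          gcongr
          · exact min_le_right _ _
          · linarith
      _ = ε / 2 := by field_simp
  refine ⟨(κ⁻¹) ^ s.card, fun z _ => ?_⟩
  refine le_of_tendsto (hasProd_canonicalProduct ha z).norm ?_
  filter_upwards [eventually_ge_atTop s] with t ht
  classical
  rw [← Finset.prod_sdiff ht]
  have h1 : ∏ i ∈ s, ‖1 - a i * z‖ ≤ (κ⁻¹) ^ s.card * Real.exp (ε / 2 * ‖z‖) := by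
    calc ∏ i ∈ s, ‖1 - a i * z‖ ≤ ∏ i ∈ s, (κ⁻¹ * Real.exp (κ * ‖a i‖ * ‖z‖)) := by
          gcongr with i _
          rw [inv_mul_eq_div, le_div_iff₀ hκ0]
          have h2 : ‖1 - a i * z‖ ≤ 1 + ‖a i‖ * ‖z‖ := by
            simpa [norm_mul] using norm_sub_le (1 : ℂ) (a i * z)
          have h3 := Real.add_one_le_exp (κ * ‖a i‖ * ‖z‖)
          have h4 : ‖1 - a i * z‖ * κ ≤ (1 + ‖a i‖ * ‖z‖) * κ := by gcongr
          nlinarith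
      _ = (κ⁻¹) ^ s.card * Real.exp (κ * (∑ i ∈ s, ‖a i‖) * ‖z‖) := by
          rw [Finset.prod_mul_distrib, Finset.prod_const, ← Real.exp_sum, Finset.mul_sum,
            Finset.sum_mul]
      _ ≤ _ := by
          gcongr
          refine le_trans ?_ hκA
          gcongr
          exact ha.sum_le_tsum s fun i _ => norm_nonneg _
  have h2 : ∏ i ∈ t \ s, ‖1 - a i * z‖ ≤ Real.exp (ε / 2 * ‖z‖) := by
    calc ∏ i ∈ t \ s, ‖1 - a i * z‖ ≤ ∏ i ∈ t \ s, Real.exp (‖a i‖ * ‖z‖) := by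
          gcongr with i _
          exact norm_one_sub_le_exp _ _
      _ = Real.exp ((∑ i ∈ t \ s, ‖a i‖) * ‖z‖) := by rw [← Real.exp_sum, Finset.sum_mul]
      _ ≤ _ := by
          gcongr
          have h3 := Finset.sum_sdiff (f := fun i => ‖a i‖) ht
          have h4 : ∑ i ∈ t, ‖a i‖ ≤ A := ha.sum_le_tsum t fun i _ => norm_nonneg _
          have h5 := hs s le_rfl
          linarith
  calc (∏ i ∈ t \ s, ‖1 - a i * z‖) * ∏ i ∈ s, ‖1 - a i * z‖
      ≤ Real.exp (ε / 2 * ‖z‖) * ((κ⁻¹) ^ s.card * Real.exp (ε / 2 * ‖z‖)) := by gcongr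
    _ = (κ⁻¹) ^ s.card * (Real.exp (ε / 2 * ‖z‖) * Real.exp (ε / 2 * ‖z‖)) := by ring
    _ = _ := by rw [← Real.exp_add]; ring_nf

theorem canonicalProduct_ne_zero (ha : Summable fun i => ‖a i‖) {z : ℂ}
    (hz : ∀ i, 1 - a i * z ≠ 0) : canonicalProduct a z ≠ 0 := by
  have := tprod_one_add_ne_zero_of_summable (f := fun i => -(a i * z))
    (by simpa only [← sub_eq_add_neg] using hz) (by simpa [norm_mul] using ha.mul_right ‖z‖)
  simpa only [← sub_eq_add_neg, canonicalProduct] using this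

theorem one_le_norm_canonicalProduct (ha : Summable fun i => ‖a i‖) {z : ℂ}
    (hz : ∀ i, 1 ≤ ‖1 - a i * z‖) : 1 ≤ ‖canonicalProduct a z‖ := by
  refine ge_of_tendsto (hasProd_canonicalProduct ha z).norm (Eventually.of_forall fun s => ?_)
  exact one_le_prod_of_one_le fun i _ => hz i

theorem one_le_norm_prod_mul_exp (ha : Summable fun i => ‖a i‖) {z : ℂ} {g : ℝ} (hg : 0 ≤ g)
    {s : Finset ι} (hz : ∀ i ∈ s, 1 ≤ ‖1 - a i * z‖ * Real.exp (‖a i‖ * g)) :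
    1 ≤ ‖∏ i ∈ s, (1 - a i * z)‖ * Real.exp ((∑' i, ‖a i‖) * g) := by
  calc (1 : ℝ) ≤ ∏ i ∈ s, (‖1 - a i * z‖ * Real.exp (‖a i‖ * g)) := one_le_prod_of_one_le hz
    _ = ‖∏ i ∈ s, (1 - a i * z)‖ * Real.exp ((∑ i ∈ s, ‖a i‖) * g) := by
      rw [Finset.prod_mul_distrib, ← Real.exp_sum, ← Finset.sum_mul, norm_prod]
    _ ≤ _ := by
      gcongr
      exact ha.sum_le_tsum s fun i _ => norm_nonneg _

theorem one_le_norm_canonicalProduct_mul_exp (ha : Summable fun i => ‖a i‖) {z : ℂ} {g : ℝ}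
    (hg : 0 ≤ g) (hz : ∀ i, 1 ≤ ‖1 - a i * z‖ * Real.exp (‖a i‖ * g)) :
    1 ≤ ‖canonicalProduct a z‖ * Real.exp ((∑' i, ‖a i‖) * g) :=
  ge_of_tendsto ((hasProd_canonicalProduct ha z).norm.mul_const _)
    (Eventually.of_forall fun s => by
      simpa [norm_prod] using one_le_norm_prod_mul_exp ha hg (s := s) fun i _ => hz i)

theorem one_le_norm_one_sub_mul_exp {b z : ℂ} (h : ‖b‖ * (2 * ‖z‖) ≤ 1) {g : ℝ}
    (hg : 2 * ‖z‖ ≤ g) : 1 ≤ ‖1 - b * z‖ * Real.exp (‖b‖ * g) := by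
  set t := ‖b‖ * ‖z‖ with ht
  have ht0 : 0 ≤ t := by positivity
  have ht1 : t ≤ 1 / 2 := by linarith
  have h1 : 1 - t ≤ ‖1 - b * z‖ := by
    simpa [norm_mul] using norm_sub_norm_le (1 : ℂ) (b * z)
  have h2 : 1 + 2 * t ≤ Real.exp (‖b‖ * g) := by
    have h3 := Real.add_one_le_exp (‖b‖ * g)
    have h4 : ‖b‖ * (2 * ‖z‖) ≤ ‖b‖ * g := by gcongr
    linarith
  calc (1 : ℝ) ≤ (1 - t) * (1 + 2 * t) := by nlinarith
    _ ≤ _ := mul_le_mul h1 h2 (by linarith) (norm_nonneg _)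

/-- A canonical product with real zeros is bounded below by the inverse of a function of order
`3 / 2` on `{Im z ≥ h}`. -/
theorem orderOn_inv_canonicalProduct (ha : Summable fun i => ‖a i‖) (hreal : ∀ i, (a i).im = 0)
    {h : ℝ} (hh : 0 < h) : OrderOn {z | h ≤ z.im} (fun z => (canonicalProduct a z)⁻¹) := by
  set A := ∑' i, ‖a i‖ with hA
  have hA0 : 0 ≤ A := tsum_nonneg fun i => norm_nonneg _
  set K : ℝ := 2 * (1 + 1 / h) with hK
  have hK0 : 0 < K := by positivity
  refine ⟨A * (2 * (1 + K)), fun z hz => ?_⟩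
  have hz' : h ≤ z.im := hz
  set r := ‖z‖ with hr
  have hr0 : 0 < r := (hh.trans_le hz').trans_le ((le_abs_self _).trans (abs_im_le_norm z))
  set g : ℝ := 2 * (1 + K) * (1 + r) ^ (3 / 2 : ℝ) with hg
  have hq : (1 + r) ^ (3 / 2 : ℝ) = (1 + r) * √(1 + r) := by
    rw [Real.sqrt_eq_rpow, ← Real.rpow_one_add' (by positivity) (by norm_num)]
    norm_num
  -- A factor with `|aᵢ| ≥ 1 / (2r)` may be as small as `|aᵢ| h`, so `exp(|aᵢ| g)` has to make up
  -- for `2r / h`. Taking `g` of size `r^(3/2)` gives `|aᵢ| g ≥ K √(1 + r)`, and the quadratic term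
  -- of `exp` suffices.
  have hp := one_add_le_rpow hr0.le
  have hg0 : 0 ≤ g := by positivity
  have hg1 : 2 * r ≤ g := by
    have : 0 ≤ K * (1 + r) ^ (3 / 2 : ℝ) := by positivity
    nlinarith
  have key : ∀ i, 1 ≤ ‖1 - a i * z‖ * Real.exp (‖a i‖ * g) := by
    intro i
    rcases le_total (‖a i‖ * (2 * r)) 1 with h1 | h1
    · exact one_le_norm_one_sub_mul_exp h1 hg1
    · have h2 : ‖a i‖ * h ≤ ‖1 - a i * z‖ := by
        have h3 : |(a i).re| = ‖a i‖ := (abs_re_eq_norm).2 (hreal i)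
        calc ‖a i‖ * h ≤ |(a i).re| * |z.im| := by
              rw [h3]
              gcongr
              exact hz'.trans (le_abs_self _)
          _ = |(1 - a i * z).im| := by
              rw [← abs_mul]
              simp [hreal i]
          _ ≤ _ := abs_im_le_norm _
      have h4 : K * √(1 + r) ≤ ‖a i‖ * g := by
        have h5 : K * √(1 + r) * (2 * r) ≤ g := by
          rw [hg, hq]
          have : 0 ≤ √(1 + r) := Real.sqrt_nonneg _
          have h6 : 0 ≤ K * √(1 + r) := by positivity
          have h7 : 0 ≤ (1 + r) * √(1 + r) := by positivity
          nlinarith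
        calc K * √(1 + r) ≤ K * √(1 + r) * (‖a i‖ * (2 * r)) :=
              le_mul_of_one_le_right (by positivity) h1
          _ = ‖a i‖ * (K * √(1 + r) * (2 * r)) := by ring
          _ ≤ _ := by gcongr
      have h5 : 2 * r / h ≤ Real.exp (‖a i‖ * g) := by
        have h6 := Real.quadratic_le_exp_of_nonneg (x := K * √(1 + r)) (by positivity)
        have h7 : (K * √(1 + r)) ^ 2 = K ^ 2 * (1 + r) := by
          rw [mul_pow, Real.sq_sqrt (by positivity)]
        have h8 : 4 * (1 / h) ≤ K ^ 2 := by
          rw [hK]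
          have : 0 < 1 / h := by positivity
          nlinarith
        have h9 : 2 * r / h = 4 * (1 / h) * r / 2 := by ring
        have h10 : 4 * (1 / h) * r ≤ K ^ 2 * (1 + r) := by
          gcongr
          linarith
        have h11 : 0 ≤ K * √(1 + r) := by positivity
        calc 2 * r / h ≤ Real.exp (K * √(1 + r)) := by linarith
          _ ≤ _ := Real.exp_le_exp.2 h4
      calc (1 : ℝ) ≤ ‖a i‖ * (2 * r) := h1
        _ = ‖a i‖ * h * (2 * r / h) := by field_simp
        _ ≤ _ := mul_le_mul h2 h5 (by positivity) (norm_nonneg _)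
  have h1 := one_le_norm_canonicalProduct_mul_exp ha hg0 key
  rw [norm_inv, mul_assoc]
  refine inv_le_of_inv_le₀ (Real.exp_pos _) ?_
  rw [inv_le_iff_one_le_mul₀ (Real.exp_pos _)]
  exact h1

/-! ### Division by a canonical product -/

theorem exists_eq_mul_prod (ha0 : ∀ i, a i ≠ 0) (hinj : Function.Injective a) {P : ℂ → ℂ}
    (hP : Differentiable ℂ P) (hzero : ∀ i, P (a i)⁻¹ = 0) (s : Finset ι) :
    ∃ Q : ℂ → ℂ, Differentiable ℂ Q ∧ ∀ z, P z = Q z * ∏ i ∈ s, (1 - a i * z) := by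
  classical
  induction s using Finset.induction_on with
  | empty => exact ⟨P, hP, by simp⟩
  | insert j s hj ih =>
    obtain ⟨Q, hQ, hPQ⟩ := ih
    have hQ0 : Q (a j)⁻¹ = 0 := by
      have h1 := hPQ (a j)⁻¹
      rw [hzero j] at h1
      refine (mul_eq_zero.1 h1.symm).resolve_right (Finset.prod_ne_zero_iff.2 ?_)
      intro i hi h2
      have h3 : a i = a j := by
        rw [sub_eq_zero, ← div_eq_mul_inv, eq_div_iff (ha0 j), one_mul] at h2
        exact h2.symm
      exact hj (hinj h3 ▸ hi)
    refine ⟨fun z => -(a j)⁻¹ * dslope Q (a j)⁻¹ z, ?_, fun z => ?_⟩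
    · refine Differentiable.const_mul ?_ _
      rw [← differentiableOn_univ, differentiableOn_dslope univ_mem]
      exact hQ.differentiableOn
    · have h1 : Q z = (z - (a j)⁻¹) * dslope Q (a j)⁻¹ z := by
        rw [← smul_eq_mul, sub_smul_dslope, hQ0, sub_zero]
      have h2 : z - (a j)⁻¹ = (1 - a j * z) * -(a j)⁻¹ := by
        have := ha0 j
        field_simp
        ring
      rw [hPQ, Finset.prod_insert hj, h1, h2]
      ring

/-- The point is a bound independent of `s`. The zeros of modulus below `2r` are those of `s₂`, and
their factors are at least one in modulus on the circle `|w| = 4r`. The other factors stay attached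
to `Q` for the maximum principle and are bounded below on `|z| ≤ r`. -/
theorem norm_le_of_eq_mul_prod (ha : Summable fun i => ‖a i‖) {P Q : ℂ → ℂ}
    (hQ : Differentiable ℂ Q) {s : Finset ι} (hPQ : ∀ z, P z = Q z * ∏ i ∈ s, (1 - a i * z))
    {r B : ℝ} (hr : 0 < r) (hB : ∀ z, ‖z‖ = 4 * r → ‖P z‖ ≤ B) {z : ℂ} (hz : ‖z‖ ≤ r) :
    ‖Q z‖ ≤ B * Real.exp ((∑' i, ‖a i‖) * (2 * r)) := by
  classical
  set s₁ := s.filter fun i => ‖a i‖ * (2 * r) ≤ 1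
  set s₂ := s.filter fun i => ¬ ‖a i‖ * (2 * r) ≤ 1
  have hsplit : ∀ w, ∏ i ∈ s, (1 - a i * w) =
      (∏ i ∈ s₁, (1 - a i * w)) * ∏ i ∈ s₂, (1 - a i * w) := fun w =>
    (Finset.prod_filter_mul_prod_filter_not s _ _).symm
  set Q₁ : ℂ → ℂ := fun w => Q w * ∏ i ∈ s₁, (1 - a i * w) with hQ₁
  have hQ₁d : Differentiable ℂ Q₁ := by fun_prop
  have hmax : ‖Q₁ z‖ ≤ B := by
    refine norm_le_of_forall_mem_frontier_norm_le (U := ball 0 (4 * r)) isBounded_ball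
      hQ₁d.diffContOnCl (fun w hw => ?_) (subset_closure ?_)
    · rw [frontier_ball _ (by positivity : 4 * r ≠ 0), mem_sphere_zero_iff_norm] at hw
      have h1 : 1 ≤ ‖∏ i ∈ s₂, (1 - a i * w)‖ := by
        rw [norm_prod]
        refine one_le_prod_of_one_le fun i hi => ?_
        have h2 : 1 < ‖a i‖ * (2 * r) := not_le.1 (Finset.mem_filter.1 hi).2
        have h3 : ‖a i * w‖ - ‖(1 : ℂ)‖ ≤ ‖1 - a i * w‖ := by
          rw [norm_sub_rev]
          exact norm_sub_norm_le _ _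
        rw [norm_mul, hw, norm_one] at h3
        linarith
      calc ‖Q₁ w‖ ≤ ‖Q₁ w‖ * ‖∏ i ∈ s₂, (1 - a i * w)‖ :=
            le_mul_of_one_le_right (norm_nonneg _) h1
        _ = ‖P w‖ := by rw [← norm_mul, hPQ, hsplit, mul_assoc]
        _ ≤ B := hB w hw
    · rw [mem_ball_zero_iff]
      linarith
  have h1 : 1 ≤ ‖∏ i ∈ s₁, (1 - a i * z)‖ * Real.exp ((∑' i, ‖a i‖) * (2 * r)) := by
    refine one_le_norm_prod_mul_exp ha (by positivity) fun i hi => ?_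
    have h2 : ‖a i‖ * (2 * r) ≤ 1 := (Finset.mem_filter.1 hi).2
    refine one_le_norm_one_sub_mul_exp (le_trans ?_ h2) (by linarith)
    gcongr
  calc ‖Q z‖ ≤ ‖Q z‖ * (‖∏ i ∈ s₁, (1 - a i * z)‖ * Real.exp ((∑' i, ‖a i‖) * (2 * r))) :=
        le_mul_of_one_le_right (norm_nonneg _) h1
    _ = ‖Q₁ z‖ * Real.exp ((∑' i, ‖a i‖) * (2 * r)) := by rw [← mul_assoc, ← norm_mul]
    _ ≤ _ := by gcongr

/-- An entire function of minimal exponential growth vanishing at the zeros of a canonical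
product is divisible by it, with a quotient of exponential type. -/
theorem exists_eq_mul_canonicalProduct (ha : Summable fun i => ‖a i‖) (ha0 : ∀ i, a i ≠ 0)
    (hinj : Function.Injective a) {P : ℂ → ℂ} (hP : Differentiable ℂ P)
    (hPs : SubexpOn univ P) (hzero : ∀ i, P (a i)⁻¹ = 0) :
    ∃ F : ℂ → ℂ, Differentiable ℂ F ∧ OrderOn univ F ∧
      ∀ z, P z = F z * canonicalProduct a z := by
  choose Q hQ hPQ using exists_eq_mul_prod ha0 hinj hP hzero
  obtain ⟨C, hC0, hC⟩ := hPs.exists_pos one_pos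
  set A := ∑' i, ‖a i‖ with hA
  have hA0 : 0 ≤ A := tsum_nonneg fun i => norm_nonneg _
  have hbound : ∀ s z, ∀ r, 0 < r → ‖z‖ ≤ r →
      ‖Q s z‖ ≤ C * Real.exp (4 * r) * Real.exp (A * (2 * r)) := fun s z r hr hz =>
    norm_le_of_eq_mul_prod ha (hQ s) (hPQ s) hr (fun w hw => by
      simpa [hw] using hC w (mem_univ _)) hz
  -- The quotients by finite partial products are locally bounded uniformly in `s`; the full
  -- quotient is a limit of them.
  obtain ⟨F, hF, hlim⟩ := exists_tendstoLocallyUniformly_ultrafilter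
    (Ultrafilter.of (atTop : Filter (Finset ι))) hQ
    fun R => ⟨_, fun s z hz => hbound s z (|R| + 1) (by positivity)
      (by linarith [le_abs_self R])⟩
  have hpt : ∀ z, Tendsto (fun s => Q s z) (Ultrafilter.of (atTop : Filter (Finset ι)))
      (𝓝 (F z)) := fun z =>
    (tendstoLocallyUniformlyOn_univ.2 hlim).tendsto_at (mem_univ z)
  refine ⟨F, hF, ⟨C + 4 + A * 2, fun z _ => ?_⟩, fun z => ?_⟩
  · have h1 : ‖F z‖ ≤ C * Real.exp (4 * (1 + ‖z‖)) * Real.exp (A * (2 * (1 + ‖z‖))) :=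
      le_of_tendsto (hpt z).norm (Eventually.of_forall fun s =>
        hbound s z _ (by positivity) (by linarith))
    have h2 : C ≤ Real.exp C := by linarith [Real.add_one_le_exp C]
    have h3 := one_add_le_rpow (norm_nonneg z)
    refine h1.trans ?_
    calc C * Real.exp (4 * (1 + ‖z‖)) * Real.exp (A * (2 * (1 + ‖z‖)))
        ≤ Real.exp C * Real.exp (4 * (1 + ‖z‖)) * Real.exp (A * (2 * (1 + ‖z‖))) := by gcongr
      _ = Real.exp (C + 4 * (1 + ‖z‖) + A * (2 * (1 + ‖z‖))) := by
          rw [← Real.exp_add, ← Real.exp_add]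
      _ ≤ _ := by
          gcongr
          have h4 : C ≤ C * (1 + ‖z‖) ^ (3 / 2 : ℝ) :=
            le_mul_of_one_le_right hC0.le (by linarith [norm_nonneg z])
          have h5 : A * 2 * (1 + ‖z‖) ≤ A * 2 * (1 + ‖z‖) ^ (3 / 2 : ℝ) := by gcongr
          linarith
  · have h1 := (hpt z).mul ((hasProd_canonicalProduct ha z).mono_left (Ultrafilter.of_le atTop))
    refine tendsto_nhds_unique (tendsto_const_nhds.congr fun s => ?_) h1
    exact hPQ s z

end CanonicalProduct

/-! ### Pairs of entire functions with a Herglotz quotient -/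

section HerglotzPair

variable {ι : Type*} {a : ι → ℂ} {φ ψ : ℂ → ℂ}

/-- Entire functions `φ`, `ψ` of exponential type zero, normalized at the origin, such that
`z φ ψ / ∏ (1 - aᵢ z)` has nonnegative imaginary part in the upper half-plane. -/
structure IsHerglotzPair (a : ι → ℂ) (φ ψ : ℂ → ℂ) : Prop where
  diff_left : Differentiable ℂ φ
  diff_right : Differentiable ℂ ψ
  subexp_left : SubexpOn univ φ
  subexp_right : SubexpOn univ ψ
  left_zero : φ 0 = 1
  right_zero : ψ 0 = 1
  nonneg : ∀ z : ℂ, 0 < z.im → 0 ≤ (z * φ z * ψ z / canonicalProduct a z).im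

theorem IsHerglotzPair.symm (h : IsHerglotzPair a φ ψ) : IsHerglotzPair a ψ φ where
  diff_left := h.diff_right
  diff_right := h.diff_left
  subexp_left := h.subexp_right
  subexp_right := h.subexp_left
  left_zero := h.right_zero
  right_zero := h.left_zero
  nonneg z hz := by rw [mul_right_comm]; exact h.nonneg z hz

theorem one_sub_ne_zero_of_im_ne_zero {b z : ℂ} (hb : b.im = 0) (hz : z.im ≠ 0) :
    1 - b * z ≠ 0 := by
  intro h
  have h1 := congrArg im h
  simp [hb] at h1
  rcases h1 with h1 | h1
  · have h2 : b = 0 := Complex.ext h1 hb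
    simp [h2] at h
  · exact hz h1

theorem canonicalProduct_ne_zero_of_im_ne_zero (ha : Summable fun i => ‖a i‖)
    (hreal : ∀ i, (a i).im = 0) {z : ℂ} (hz : z.im ≠ 0) : canonicalProduct a z ≠ 0 :=
  canonicalProduct_ne_zero ha fun i => one_sub_ne_zero_of_im_ne_zero (hreal i) hz

theorem norm_one_sub_mul_I {b : ℂ} (hb : b.im = 0) (y : ℝ) :
    ‖1 - b * (y * I)‖ = ‖1 - (-(‖b‖ : ℂ)) * (y * I)‖ := by
  have h : ‖b‖ ^ 2 = b.re * b.re := by rw [← normSq_eq_norm_sq, normSq_apply, hb]; ring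
  rw [← sq_eq_sq₀ (norm_nonneg _) (norm_nonneg _), ← normSq_eq_norm_sq, ← normSq_eq_norm_sq,
    normSq_apply, normSq_apply]
  simp [hb]
  linear_combination -(y ^ 2) * h

theorem one_le_norm_canonicalProduct_mul_I (ha : Summable fun i => ‖a i‖)
    (hreal : ∀ i, (a i).im = 0) (y : ℝ) : 1 ≤ ‖canonicalProduct a (y * I)‖ := by
  refine one_le_norm_canonicalProduct ha fun i => ?_
  refine le_trans ?_ ((le_abs_self _).trans (abs_re_le_norm _))
  simp [hreal i]

variable (ha : Summable fun i => ‖a i‖) (hreal : ∀ i, (a i).im = 0)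

include ha hreal

theorem IsHerglotzPair.differentiableOn (h : IsHerglotzPair a φ ψ) :
    DifferentiableOn ℂ (fun z => z * φ z * ψ z / canonicalProduct a z) {z | 0 < z.im} :=
  DifferentiableOn.div
    ((differentiable_id.mul h.diff_left).mul h.diff_right).differentiableOn
    (differentiable_canonicalProduct ha).differentiableOn
    fun _ hz => canonicalProduct_ne_zero_of_im_ne_zero ha hreal (ne_of_gt hz)

-- In terms of `M`, this is `M(iε) / ε → i`: the angular derivative at the boundary fixed point `0`
-- equals one.
omit hreal in
theorem IsHerglotzPair.tendsto_I (h : IsHerglotzPair a φ ψ) :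
    Tendsto (fun ε : ℝ => I * φ (ε * I) * ψ (ε * I) / canonicalProduct a (ε * I)) (𝓝[>] 0)
      (𝓝 I) := by
  have hφ := h.diff_left.continuous
  have hψ := h.diff_right.continuous
  have hE := (differentiable_canonicalProduct ha).continuous
  have h0 : Tendsto (fun ε : ℝ => (ε : ℂ) * I) (𝓝[>] 0) (𝓝 0) :=
    (Continuous.tendsto' (by fun_prop) _ _ (by simp)).mono_left nhdsWithin_le_nhds
  have h1 := (hφ.tendsto 0).comp h0
  have h2 := (hψ.tendsto 0).comp h0
  have h3 := (hE.tendsto 0).comp h0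
  have h4 := ((h1.const_mul I).mul h2).div h3 (by simp [canonicalProduct_zero])
  simpa [Function.comp_def, Pi.div_def, h.left_zero, h.right_zero, canonicalProduct_zero] using h4

/-- A form of Julia's lemma at the boundary fixed point `0`. -/
theorem IsHerglotzPair.norm_mul_im_le (h : IsHerglotzPair a φ ψ) {z : ℂ} (hz : 0 < z.im) :
    ‖z * φ z * ψ z / canonicalProduct a z‖ * z.im ≤ ‖z‖ ^ 2 := by
  set M : ℂ → ℂ := fun z => z * φ z * ψ z / canonicalProduct a z with hM
  set N : ℝ → ℂ := fun ε => I * φ (ε * I) * ψ (ε * I) / canonicalProduct a (ε * I) with hN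
  have hNt : Tendsto N (𝓝[>] 0) (𝓝 I) := h.tendsto_I ha
  have hMN : ∀ ε : ℝ, M (ε * I) = ε * N ε := fun ε => by simp only [hM, hN]; ring
  have h0 : Tendsto (fun ε : ℝ => (ε : ℂ)) (𝓝[>] 0) (𝓝 0) :=
    (Continuous.tendsto' (by fun_prop) _ _ (by simp)).mono_left nhdsWithin_le_nhds
  -- Schwarz–Pick for the points `z` and `iε`, divided by `ε`; the limit is `Im z |M(z)|² ≤ Im M(z)
  -- |z|²`.
  have key : ∀ ε : ℝ, 0 < ε → z.im * ‖M z - conj ((ε : ℂ) * N ε)‖ ^ 2 ≤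
      (M z).im * (N ε).im * ‖z - conj ((ε : ℂ) * I)‖ ^ 2 := by
    intro ε hε
    have h1 := schwarzPick (h.differentiableOn ha hreal) h.nonneg hz
      (w := (ε : ℂ) * I) (by simpa using hε)
    change z.im * _ * ‖M z - conj (M (ε * I))‖ ^ 2 ≤ (M z).im * (M (ε * I)).im * _ at h1
    rw [hMN, im_ofReal_mul, im_ofReal_mul, I_im, mul_one] at h1
    refine le_of_mul_le_mul_left ?_ hε
    linarith
  have hL : Tendsto (fun ε : ℝ => z.im * ‖M z - conj ((ε : ℂ) * N ε)‖ ^ 2) (𝓝[>] 0)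
      (𝓝 (z.im * ‖M z - conj (0 * I)‖ ^ 2)) :=
    ((tendsto_const_nhds.sub
      ((continuous_conj.tendsto _).comp (h0.mul hNt))).norm.pow 2).const_mul _
  have hR : Tendsto (fun ε : ℝ => (M z).im * (N ε).im * ‖z - conj ((ε : ℂ) * I)‖ ^ 2) (𝓝[>] 0)
      (𝓝 ((M z).im * I.im * ‖z - conj (0 * I)‖ ^ 2)) :=
    (((continuous_im.tendsto _).comp hNt).const_mul _).mul ((tendsto_const_nhds.sub
      ((continuous_conj.tendsto _).comp (h0.mul_const I))).norm.pow 2)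
  have h1 := le_of_tendsto_of_tendsto hL hR
    (by filter_upwards [self_mem_nhdsWithin] with ε hε using key ε hε)
  simp only [zero_mul, map_zero, sub_zero, I_im, mul_one] at h1
  change ‖M z‖ * z.im ≤ ‖z‖ ^ 2
  rcases (norm_nonneg (M z)).eq_or_lt with h2 | h2
  · rw [← h2, zero_mul]
    positivity
  · refine le_of_mul_le_mul_left ?_ h2
    have h3 : (M z).im ≤ ‖M z‖ := (le_abs_self _).trans (abs_im_le_norm _)
    have h4 : (M z).im * ‖z‖ ^ 2 ≤ ‖M z‖ * ‖z‖ ^ 2 := by gcongr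
    nlinarith

/-- If `Im M(i) = 0`, Schwarz–Pick forces `M` to be constant. Julia's bound along `iε` makes the
constant zero, contradicting `M(iε) / ε → i`. -/
theorem IsHerglotzPair.im_I_pos (h : IsHerglotzPair a φ ψ) :
    0 < (I * φ I * ψ I / canonicalProduct a I).im := by
  set M : ℂ → ℂ := fun z => z * φ z * ψ z / canonicalProduct a z with hM
  change 0 < (M I).im
  refine (h.nonneg I (by simp)).lt_of_ne fun h0 => ?_
  change 0 = (M I).im at h0
  have hconst : ∀ z : ℂ, 0 < z.im → M z = conj (M I) := by
    intro z hz
    have h1 := schwarzPick (h.differentiableOn ha hreal) h.nonneg hz (w := I) (by simp)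
    change z.im * I.im * ‖M z - conj (M I)‖ ^ 2 ≤ (M z).im * (M I).im * _ at h1
    rw [← h0, I_im, mul_one, mul_zero, zero_mul] at h1
    have h2 : ‖M z - conj (M I)‖ ^ 2 ≤ 0 := nonpos_of_mul_nonpos_right h1 hz
    have h3 : ‖M z - conj (M I)‖ = 0 := by
      simpa using le_antisymm h2 (sq_nonneg _)
    exact sub_eq_zero.1 (norm_eq_zero.1 h3)
  have hsmall : ∀ ε : ℝ, 0 < ε → ‖M I‖ ≤ ε := by
    intro ε hε
    have h1 := h.norm_mul_im_le ha hreal (z := (ε : ℂ) * I) (by simpa using hε)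
    change ‖M (ε * I)‖ * _ ≤ _ at h1
    rw [hconst _ (by simpa using hε), RCLike.norm_conj] at h1
    simp only [im_ofReal_mul, I_im, mul_one, norm_mul, norm_real, norm_I,
      Real.norm_of_nonneg hε.le] at h1
    nlinarith
  have hMI : M I = 0 := norm_eq_zero.1
    (le_antisymm (le_of_forall_pos_le_add fun ε hε => by simpa using hsmall ε hε) (norm_nonneg _))
  have h1 : Tendsto (fun _ : ℝ => (0 : ℂ)) (𝓝[>] 0) (𝓝 I) := by
    refine (h.tendsto_I ha).congr' ?_
    filter_upwards [self_mem_nhdsWithin] with ε hε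
    have hε0 : (ε : ℂ) ≠ 0 := ofReal_ne_zero.2 (ne_of_gt hε)
    have h2 : M (ε * I) = 0 := by
      rw [hconst _ (by simpa using hε), hMI, map_zero]
    have h3 : M (ε * I) =
        ε * (I * φ (ε * I) * ψ (ε * I) / canonicalProduct a (ε * I)) := by
      simp only [hM]
      ring
    rw [h3] at h2
    exact (mul_eq_zero.1 h2).resolve_left hε0
  exact I_ne_zero (tendsto_nhds_unique h1 tendsto_const_nhds)

/-- Schwarz–Pick against the fixed point `i` bounds `|M|` from below. This excludes zeros of `φ` and
`ψ` and gives polynomial growth of `1/M` on `Im z ≥ k`. -/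
theorem IsHerglotzPair.im_mul_le (h : IsHerglotzPair a φ ψ) {z : ℂ} (hz : 0 < z.im) :
    z.im * (I * φ I * ψ I / canonicalProduct a I).im ≤
      ‖z * φ z * ψ z / canonicalProduct a z‖ * (1 + ‖z‖) ^ 2 := by
  have hm := h.im_I_pos ha hreal
  have hMz := h.nonneg z hz
  have h1 := schwarzPick (h.differentiableOn ha hreal) h.nonneg hz (w := I) (by simp)
  beta_reduce at h1
  set m := I * φ I * ψ I / canonicalProduct a I
  set u := z * φ z * ψ z / canonicalProduct a z
  have h2 : m.im ≤ ‖u - conj m‖ := by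
    refine le_trans ?_ ((le_abs_self _).trans (abs_im_le_norm _))
    simpa using hMz
  have h3 : u.im ≤ ‖u‖ := (le_abs_self _).trans (abs_im_le_norm _)
  have h4 : ‖z - conj I‖ ≤ 1 + ‖z‖ := by
    refine (norm_sub_le _ _).trans ?_
    simp [add_comm]
  rw [I_im, mul_one] at h1
  refine le_of_mul_le_mul_left ?_ hm
  calc m.im * (z.im * m.im) = z.im * m.im ^ 2 := by ring
    _ ≤ z.im * ‖u - conj m‖ ^ 2 := by gcongr
    _ ≤ u.im * m.im * ‖z - conj I‖ ^ 2 := h1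
    _ ≤ ‖u‖ * m.im * (1 + ‖z‖) ^ 2 := by gcongr
    _ = _ := by ring

theorem IsHerglotzPair.ne_zero (h : IsHerglotzPair a φ ψ) {z : ℂ} (hz : 0 < z.im) :
    φ z ≠ 0 ∧ ψ z ≠ 0 := by
  have h1 := h.im_mul_le ha hreal hz
  have h2 := mul_pos hz (h.im_I_pos ha hreal)
  constructor <;> intro h0 <;> simp [h0] at h1 <;> linarith

/-- Bounds for `1/φ` follow from those for `ψ`, the inverse canonical product and `1/M`. -/
theorem IsHerglotzPair.inv_eq (h : IsHerglotzPair a φ ψ) {z : ℂ} (hz : 0 < z.im) :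
    (φ z)⁻¹ = z * ψ z * (canonicalProduct a z)⁻¹ * (z * φ z * ψ z / canonicalProduct a z)⁻¹ := by
  have h1 := h.ne_zero ha hreal hz
  have h2 := canonicalProduct_ne_zero_of_im_ne_zero ha hreal hz.ne'
  have h3 : z ≠ 0 := by rintro rfl; simp at hz
  have h4 := h1.1
  have h5 := h1.2
  field_simp

theorem IsHerglotzPair.subexpOn_inv (h : IsHerglotzPair a φ ψ) {k : ℝ} (hk : 0 < k) :
    SubexpOn {z | k ≤ z.im} (fun z => (z * φ z * ψ z / canonicalProduct a z)⁻¹) := by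
  set m := (I * φ I * ψ I / canonicalProduct a I).im with hm
  have hm0 : 0 < m := h.im_I_pos ha hreal
  refine ((subexpOn_const _ ((1 / (k * m) : ℝ) : ℂ)).mul
    ((subexpOn_one_add_norm _).mul (subexpOn_one_add_norm _))).mono subset_rfl fun z hz => ?_
  have hz0 : 0 < z.im := hk.trans_le hz
  have h1 := h.im_mul_le ha hreal hz0
  have h2 : k * m ≤ z.im * m := by
    have : k ≤ z.im := hz
    gcongr
  have h3 : 0 < ‖z * φ z * ψ z / canonicalProduct a z‖ := by
    by_contra h4
    have h5 := le_antisymm (not_lt.1 h4) (norm_nonneg _)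
    rw [h5, zero_mul] at h1
    have := mul_pos hz0 hm0
    linarith
  have hkm : 0 < k * m := mul_pos hk hm0
  rw [norm_inv, norm_mul, norm_mul, norm_real, norm_real,
    Real.norm_of_nonneg (by positivity), Real.norm_of_nonneg (by positivity),
    inv_le_iff_one_le_mul₀ h3, div_mul_eq_mul_div, one_mul, div_mul_eq_mul_div, le_div_iff₀ hkm]
  linarith

theorem IsHerglotzPair.orderOn_inv_left (h : IsHerglotzPair a φ ψ) {k : ℝ} (hk : 0 < k) :
    OrderOn {z | k ≤ z.im} (fun z => (φ z)⁻¹) := by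
  have hid : SubexpOn {z | k ≤ z.im} (fun z => z) :=
    (subexpOn_one_add_norm _).mono subset_rfl fun z _ => by
      rw [norm_real, Real.norm_of_nonneg (by positivity)]
      linarith
  refine (((hid.mul (h.subexp_right.mono (subset_univ _) fun _ _ => le_rfl)).orderOn.mul
    (orderOn_inv_canonicalProduct ha hreal hk)).mul
    (h.subexpOn_inv ha hreal hk).orderOn).mono subset_rfl fun z hz => ?_
  rw [h.inv_eq ha hreal (hk.trans_le hz)]

/-- On the imaginary axis the canonical product has modulus at least one, so the loss to order `3 /
2` does not occur. This is the growth on a ray that Phragmén–Lindelöf needs. -/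
theorem IsHerglotzPair.subexpOn_inv_left (h : IsHerglotzPair a φ ψ) {k : ℝ} (hk : 0 < k) :
    SubexpOn {z | k ≤ z.im ∧ z.re = 0} (fun z => (φ z)⁻¹) := by
  have hid : SubexpOn {z | k ≤ z.im ∧ z.re = 0} (fun z => z) :=
    (subexpOn_one_add_norm _).mono subset_rfl fun z _ => by
      rw [norm_real, Real.norm_of_nonneg (by positivity)]
      linarith
  have hE : SubexpOn {z | k ≤ z.im ∧ z.re = 0} (fun z => (canonicalProduct a z)⁻¹) := by
    refine (subexpOn_const _ 1).mono subset_rfl fun z hz => ?_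
    have h1 : z = (z.im : ℂ) * I := Complex.ext (by simp [hz.2]) (by simp)
    rw [h1, norm_inv, norm_one]
    exact inv_le_one_of_one_le₀ (one_le_norm_canonicalProduct_mul_I ha hreal _)
  refine (((hid.mul (h.subexp_right.mono (subset_univ _) fun _ _ => le_rfl)).mul hE).mul
    ((h.subexpOn_inv ha hreal hk).mono (fun z hz => hz.1) fun _ _ => le_rfl)).mono
    subset_rfl fun z hz => ?_
  rw [h.inv_eq ha hreal (hk.trans_le hz.1)]

/-- On the imaginary axis, `|φ|` does not decrease under reflection upwards at a point above the
origin. -/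
theorem IsHerglotzPair.norm_reflect_le (h : IsHerglotzPair a φ ψ) {k s : ℝ} (hk : 0 < k)
    (hs : 0 ≤ s) : ‖φ (((k - s : ℝ) : ℂ) * I)‖ ≤ ‖φ (((k + s : ℝ) : ℂ) * I)‖ := by
  -- The map `w ↦ i(w + k)` carries the right half-plane to `Im z > k`. There `d` is `1/φ` and `p`
  -- has the modulus of `φ` at the point reflected in `Im z = k`, so `p d` has modulus one on the
  -- boundary.
  set p : ℂ → ℂ := fun w => conj (φ (conj (I * (w - k)))) with hp
  set d : ℂ → ℂ := fun w => (φ (I * (w + k)))⁻¹ with hd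
  have him : ∀ w : ℂ, (I * (w + k)).im = w.re + k := fun w => by simp
  have hsub : ∀ w : ℂ, ‖I * (w + k)‖ ≤ ‖w‖ + k := fun w => by
    rw [norm_mul, norm_I, one_mul]
    refine (norm_add_le _ _).trans ?_
    rw [norm_real, Real.norm_of_nonneg hk.le]
  have hsub' : ∀ w : ℂ, ‖conj (I * (w - k))‖ ≤ ‖w‖ + k := fun w => by
    rw [RCLike.norm_conj, norm_mul, norm_I, one_mul]
    refine (norm_sub_le _ _).trans ?_
    rw [norm_real, Real.norm_of_nonneg hk.le]
  have hcd : Differentiable ℂ (conj ∘ φ ∘ conj) := fun z =>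
    differentiableAt_conj_conj_iff.2 (h.diff_left _)
  have hpd : Differentiable ℂ p := hcd.comp ((differentiable_id.sub_const _).const_mul _)
  have hps : SubexpOn univ p :=
    (h.subexp_left.comp (t := univ) (g := fun w => conj (I * (w - k))) (fun _ _ => mem_univ _)
      fun w _ => hsub' w).mono subset_rfl fun w _ => by simp [hp]
  have hne : ∀ w : ℂ, 0 ≤ w.re → φ (I * (w + k)) ≠ 0 := fun w hw =>
    (h.ne_zero ha hreal (by rw [him]; linarith)).1
  have hcl : closure {z : ℂ | 0 < z.re} ⊆ {z : ℂ | 0 ≤ z.re} :=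
    closure_minimal (fun z (hz : 0 < z.re) => hz.le) (isClosed_le continuous_const continuous_re)
  have hdd : DiffContOnCl ℂ (fun w => p w * d w) {z | 0 < z.re} := by
    refine DifferentiableOn.diffContOnCl fun w hw => ?_
    have h1 : Differentiable ℂ (fun w : ℂ => φ (I * (w + k))) :=
      h.diff_left.comp ((differentiable_id.add_const _).const_mul _)
    exact ((hpd w).mul ((h1 w).inv (hne w (hcl hw)))).differentiableWithinAt
  have hmem : ∀ w : ℂ, 0 ≤ w.re → I * (w + k) ∈ {z : ℂ | k ≤ z.im} := fun w hw => by
    change k ≤ (I * (w + k)).im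
    rw [him]
    linarith
  have hdo : OrderOn {z | 0 < z.re} d :=
    (h.orderOn_inv_left ha hreal hk).comp hk.le (fun w hw => hmem w (le_of_lt hw))
      fun w _ => hsub w
  have hds : SubexpOn {z | 0 ≤ z.re ∧ z.im = 0} d :=
    (h.subexpOn_inv_left ha hreal hk).comp (g := fun w => I * (w + k))
      (fun w hw => ⟨hmem w hw.1, by simp [hw.2]⟩) fun w _ => hsub w
  have key := norm_le_of_subexpOn_ray (f := fun w => p w * d w) (C := 1) hdd
    ((hps.orderOn.mono (subset_univ _) fun _ _ => le_rfl).mul hdo)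
    ((hps.mono (subset_univ _) fun _ _ => le_rfl).mul hds) (fun x => ?_)
    (z := (s : ℂ)) (by simpa using hs)
  · have h1 : conj (I * ((s : ℂ) - k)) = ((k - s : ℝ) : ℂ) * I := by
      simp
      ring
    have h2 : I * ((s : ℂ) + k) = ((k + s : ℝ) : ℂ) * I := by
      push_cast
      ring
    have h3 : 0 < ‖φ (I * ((s : ℂ) + k))‖ := norm_pos_iff.2 (hne _ (by simpa using hs))
    simp only [hp, hd, norm_mul, norm_inv, RCLike.norm_conj] at key
    rw [mul_inv_le_iff₀ h3, one_mul, h1, h2] at key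
    exact key
  · have h1 : conj (I * ((x : ℂ) * I - k)) = I * ((x : ℂ) * I + k) := by
      simp
      ring
    simp only [hp, hd, norm_mul, norm_inv, RCLike.norm_conj]
    rw [h1]
    exact mul_inv_le_one

/-- The point `iy` is the reflection of the origin in `Im z = y / 2`. -/
theorem IsHerglotzPair.one_le_norm_mul_I (h : IsHerglotzPair a φ ψ) {y : ℝ} (hy : 0 < y) :
    1 ≤ ‖φ (y * I)‖ := by
  have h1 := h.norm_reflect_le ha hreal (half_pos hy) (half_pos hy).le
  rw [sub_self, add_halves] at h1
  simpa [h.left_zero] using h1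

theorem IsHerglotzPair.norm_neg_mul_I_le (h : IsHerglotzPair a φ ψ) {y : ℝ} (hy : 0 < y) :
    ‖φ (((-y : ℝ) : ℂ) * I)‖ ≤ ‖φ (y * I)‖ := by
  have hc := h.diff_left.continuous
  have hL : Tendsto (fun k : ℝ => ‖φ (((k - y : ℝ) : ℂ) * I)‖) (𝓝[>] 0)
      (𝓝 ‖φ (((-y : ℝ) : ℂ) * I)‖) :=
    (Continuous.tendsto' (by fun_prop) _ _ (by simp)).mono_left nhdsWithin_le_nhds
  have hR : Tendsto (fun k : ℝ => ‖φ (((k + y : ℝ) : ℂ) * I)‖) (𝓝[>] 0)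
      (𝓝 ‖φ (y * I)‖) :=
    (Continuous.tendsto' (by fun_prop) _ _ (by simp)).mono_left nhdsWithin_le_nhds
  exact le_of_tendsto_of_tendsto hL hR (by
    filter_upwards [self_mem_nhdsWithin] with k hk using h.norm_reflect_le ha hreal hk hy.le)

/-- Julia's bound at `iy` controls the product `φ ψ`; since `|ψ(iy)| ≥ 1`, it controls `φ` alone. -/
theorem IsHerglotzPair.norm_mul_I_le_of_pos (h : IsHerglotzPair a φ ψ) {y : ℝ} (hy : 0 < y) :
    ‖φ (y * I)‖ ≤ ‖canonicalProduct a (y * I)‖ := by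
  have h1 := h.norm_mul_im_le ha hreal (z := (y : ℂ) * I) (by simpa using hy)
  have h2 := h.symm.one_le_norm_mul_I ha hreal hy
  have h3 : 0 < ‖canonicalProduct a (y * I)‖ :=
    one_pos.trans_le (one_le_norm_canonicalProduct_mul_I ha hreal y)
  simp only [norm_div, norm_mul, norm_real, norm_I, Real.norm_of_nonneg hy.le, mul_one,
    im_ofReal_mul, I_im] at h1
  rw [div_mul_eq_mul_div, div_le_iff₀ h3] at h1
  have h4 : ‖φ (y * I)‖ * ‖ψ (y * I)‖ ≤ ‖canonicalProduct a (y * I)‖ := by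
    refine le_of_mul_le_mul_left ?_ (pow_pos hy 2)
    linarith
  exact (le_mul_of_one_le_right (norm_nonneg _) h2).trans h4

/-- Moving all zeros to the negative half-line keeps the modulus on the imaginary axis, but the new
product has modulus at least one in the whole right half-plane and can serve as a divisor there. -/
theorem norm_canonicalProduct_mul_I (y : ℝ) :
    ‖canonicalProduct a (y * I)‖ = ‖canonicalProduct (fun i => -(‖a i‖ : ℂ)) (y * I)‖ := by
  have hb : Summable fun i => ‖-(‖a i‖ : ℂ)‖ := by simpa using ha
  refine tendsto_nhds_unique (hasProd_canonicalProduct ha (y * I)).norm ?_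
  simp only [norm_one_sub_mul_I (hreal _)]
  exact (hasProd_canonicalProduct hb (y * I)).norm

theorem norm_canonicalProduct_neg_mul_I (y : ℝ) :
    ‖canonicalProduct a (((-y : ℝ) : ℂ) * I)‖ = ‖canonicalProduct a (y * I)‖ := by
  have h : ∀ i, ‖1 - a i * (((-y : ℝ) : ℂ) * I)‖ = ‖1 - a i * ((y : ℂ) * I)‖ := fun i => by
    rw [← sq_eq_sq₀ (norm_nonneg _) (norm_nonneg _), ← normSq_eq_norm_sq, ← normSq_eq_norm_sq,
      normSq_apply, normSq_apply]
    simp [hreal i]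
  refine tendsto_nhds_unique (hasProd_canonicalProduct ha _).norm ?_
  simp only [h]
  exact (hasProd_canonicalProduct ha _).norm

theorem IsHerglotzPair.norm_mul_I_le (h : IsHerglotzPair a φ ψ) (y : ℝ) :
    ‖φ (y * I)‖ ≤ ‖canonicalProduct (fun i => -(‖a i‖ : ℂ)) (y * I)‖ := by
  rcases lt_trichotomy y 0 with hy | rfl | hy
  · have h1 := h.norm_neg_mul_I_le ha hreal (neg_pos.2 hy)
    rw [neg_neg] at h1
    refine (h1.trans (h.norm_mul_I_le_of_pos ha hreal (neg_pos.2 hy))).trans_eq ?_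
    rw [norm_canonicalProduct_neg_mul_I ha hreal, norm_canonicalProduct_mul_I ha hreal]
  · simp [h.left_zero, canonicalProduct_zero]
  · rw [← norm_canonicalProduct_mul_I ha hreal]
    exact h.norm_mul_I_le_of_pos ha hreal hy

omit hreal in
theorem norm_le_canonicalProduct_of_re_nonneg (hφ : Differentiable ℂ φ) (hs : SubexpOn univ φ)
    (hI : ∀ y : ℝ, ‖φ (y * I)‖ ≤ ‖canonicalProduct (fun i => -(‖a i‖ : ℂ)) (y * I)‖)
    {z : ℂ} (hz : 0 ≤ z.re) :
    ‖φ z‖ ≤ ‖canonicalProduct (fun i => -(‖a i‖ : ℂ)) z‖ := by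
  have hb : Summable fun i => ‖-(‖a i‖ : ℂ)‖ := by simpa using ha
  set V := canonicalProduct (fun i => -(‖a i‖ : ℂ)) with hV
  have hV1 : ∀ w : ℂ, 0 ≤ w.re → 1 ≤ ‖V w‖ := fun w hw => by
    refine one_le_norm_canonicalProduct hb fun i => ?_
    refine le_trans ?_ ((le_abs_self _).trans (abs_re_le_norm _))
    have : 0 ≤ ‖a i‖ * w.re := by positivity
    simpa using this
  have hV0 : ∀ w : ℂ, 0 ≤ w.re → V w ≠ 0 := fun w hw =>
    norm_pos_iff.1 (one_pos.trans_le (hV1 w hw))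
  have hcl : closure {z : ℂ | 0 < z.re} ⊆ {z : ℂ | 0 ≤ z.re} :=
    closure_minimal (fun z (hz : 0 < z.re) => hz.le) (isClosed_le continuous_const continuous_re)
  have hsub : SubexpOn {w | 0 ≤ w.re} (fun w => φ w / V w) :=
    hs.mono (subset_univ _) fun w hw => by
      rw [norm_div]
      exact div_le_self (norm_nonneg _) (hV1 w hw)
  have key := norm_le_of_subexpOn_ray (f := fun w => φ w / V w) (C := 1)
    (DifferentiableOn.diffContOnCl (hφ.differentiableOn.div
      (differentiable_canonicalProduct hb).differentiableOn fun w hw => hV0 w (hcl hw)))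
    (hsub.orderOn.mono (fun w (hw : 0 < w.re) => hw.le) fun _ _ => le_rfl)
    (hsub.mono (fun w hw => hw.1) fun _ _ => le_rfl) (fun x => ?_) hz
  · rwa [norm_div, div_le_one (one_pos.trans_le (hV1 z hz))] at key
  · rw [norm_div]
    exact div_le_one_of_le₀ (hI x) (norm_nonneg _)

/-- The members of Herglotz pairs satisfy a uniform growth bound. -/
theorem IsHerglotzPair.exists_uniform_bound {ε : ℝ} (hε : 0 < ε) :
    ∃ C : ℝ, 0 < C ∧ ∀ φ ψ : ℂ → ℂ, IsHerglotzPair a φ ψ →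
      ∀ z, ‖φ z‖ ≤ C * Real.exp (ε * ‖z‖) := by
  have hb : Summable fun i => ‖-(‖a i‖ : ℂ)‖ := by simpa using ha
  obtain ⟨C, hC0, hC⟩ := (subexpOn_canonicalProduct hb).exists_pos hε
  refine ⟨C, hC0, fun φ ψ h z => ?_⟩
  rcases le_total 0 z.re with hz | hz
  · exact (norm_le_canonicalProduct_of_re_nonneg ha h.diff_left h.subexp_left
      (h.norm_mul_I_le ha hreal) hz).trans (hC z (mem_univ z))
  -- The left half-plane is reduced to the right one by `w ↦ -w`; the comparison product is
  -- symmetric in modulus on the imaginary axis.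
  · have h1 := norm_le_canonicalProduct_of_re_nonneg ha (φ := fun w => φ (-w))
      (h.diff_left.comp differentiable_neg)
      (h.subexp_left.comp (K := 0) (g := fun w => -w) (fun _ _ => mem_univ _) (by simp))
      (fun y => ?_) (z := -z) (by simpa using hz)
    · rw [neg_neg] at h1
      simpa using h1.trans (hC (-z) (mem_univ _))
    · have h2 := h.norm_mul_I_le ha hreal (-y)
      rw [← norm_canonicalProduct_mul_I ha hreal] at h2 ⊢
      rw [norm_canonicalProduct_neg_mul_I ha hreal] at h2
      simpa using h2

end HerglotzPair

/-- A Liouville theorem for entire functions bounded by `|z| / Im z` in the upper half-plane. -/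
theorem eq_one_of_norm_mul_im_le {F : ℂ → ℂ} (hF : Differentiable ℂ F) (hO : OrderOn univ F)
    (hray : SubexpOn {z | z.im ≤ 1 ∧ z.re = 0} F)
    (hb : ∀ z : ℂ, 0 < z.im → ‖F z‖ * z.im ≤ ‖z‖) (h0 : F 0 = 1) (z : ℂ) : F z = 1 := by
  have hnorm : ∀ w : ℂ, ‖I * (1 - w)‖ ≤ ‖w‖ + 1 := fun w => by
    rw [norm_mul, norm_I, one_mul]
    refine (norm_sub_le _ _).trans ?_
    rw [norm_one, add_comm]
  have hden : ∀ w : ℂ, 0 ≤ w.re → 1 ≤ ‖1 + w‖ := fun w hw => by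
    refine le_trans ?_ ((le_abs_self _).trans (abs_re_le_norm _))
    simpa using hw
  have hq : ∀ w : ℂ, 0 ≤ w.re → ‖F (I * (1 - w)) / (1 + w)‖ ≤ ‖F (I * (1 - w))‖ := fun w hw => by
    rw [norm_div]
    exact div_le_self (norm_nonneg _) (hden w hw)
  have hcl : closure {z : ℂ | 0 < z.re} ⊆ {z : ℂ | 0 ≤ z.re} :=
    closure_minimal (fun z (hz : 0 < z.re) => hz.le) (isClosed_le continuous_const continuous_re)
  -- Phragmén–Lindelöf in `Im z ≤ 1`, parametrized by `z = i(1 - w)`. On the boundary line `Im z =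
  -- 1` the hypothesis reads `|F(z)| ≤ |z| = |1 + w|`, so the quotient by `1 + w` is bounded by one.
  have hlow : ∀ w : ℂ, 0 ≤ w.re → ‖F (I * (1 - w))‖ ≤ ‖1 + w‖ := by
    intro w hw
    have key := norm_le_of_subexpOn_ray (f := fun w => F (I * (1 - w)) / (1 + w)) (C := 1)
      (DifferentiableOn.diffContOnCl (DifferentiableOn.div
        (hF.comp ((differentiable_id.const_sub _).const_mul _)).differentiableOn
        (differentiable_id.const_add _).differentiableOn
        fun w hw => norm_pos_iff.1 (one_pos.trans_le (hden w (hcl hw)))))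
      ((hO.comp (t := {z | 0 < z.re}) zero_le_one (fun _ _ => mem_univ _)
        fun w _ => hnorm w).mono subset_rfl fun w hw => hq w (le_of_lt hw))
      ((hray.comp (t := {z | 0 ≤ z.re ∧ z.im = 0}) (fun w hw => ⟨by simpa using hw.1,
        by simp [hw.2]⟩) fun w _ => hnorm w).mono subset_rfl fun w hw => hq w hw.1)
      (fun x => ?_) hw
    · rwa [norm_div, div_le_one (one_pos.trans_le (hden w hw))] at key
    · have h1 := hb (I * (1 - x * I)) (by simp)
      have h2 : ‖I * (1 - x * I)‖ = ‖1 + x * I‖ := by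
        rw [norm_mul, norm_I, one_mul, ← sq_eq_sq₀ (norm_nonneg _) (norm_nonneg _),
          ← normSq_eq_norm_sq, ← normSq_eq_norm_sq, normSq_apply, normSq_apply]
        simp
      have h3 : (I * (1 - x * I)).im = 1 := by simp
      rw [h2, h3, mul_one] at h1
      rw [norm_div]
      exact div_le_one_of_le₀ h1 (norm_nonneg _)
  have hlin : ∀ z, ‖F z‖ ≤ 2 + ‖z‖ := by
    intro z
    rcases le_total z.im 1 with hz | hz
    · have h1 := hlow (1 + I * z) (by simpa using hz)
      have h2 : I * (1 - (1 + I * z)) = z := by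
        linear_combination (-z) * I_mul_I
      rw [h2] at h1
      refine h1.trans ?_
      calc ‖1 + (1 + I * z)‖ ≤ ‖(1 : ℂ)‖ + (‖(1 : ℂ)‖ + ‖I * z‖) :=
            (norm_add_le _ _).trans (add_le_add_right (norm_add_le _ _) _)
        _ = 2 + ‖z‖ := by
            rw [norm_mul, norm_I, norm_one]
            ring
    · have h1 := hb z (one_pos.trans_le hz)
      have h2 : ‖F z‖ ≤ ‖F z‖ * z.im := le_mul_of_one_le_right (norm_nonneg _) hz
      linarith
  set D : ℂ → ℂ := dslope F 0 with hD
  have hDd : Differentiable ℂ D := by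
    rw [← differentiableOn_univ, hD, differentiableOn_dslope univ_mem]
    exact hF.differentiableOn
  have hFD : ∀ z, F z = 1 + z * D z := fun z => by
    have h1 := sub_smul_dslope F 0 z
    rw [smul_eq_mul, sub_zero, h0] at h1
    rw [hD, h1]
    ring
  have hbdd : Bornology.IsBounded (range D) := by
    obtain ⟨B, hB⟩ := (isCompact_closedBall (0 : ℂ) 1).exists_bound_of_continuousOn
      hDd.continuous.continuousOn
    refine isBounded_iff_forall_norm_le.2 ⟨max B 4, ?_⟩
    rintro _ ⟨z, rfl⟩
    rcases le_total ‖z‖ 1 with hz | hz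
    · exact (hB z (by simpa using hz)).trans (le_max_left _ _)
    · refine le_trans ?_ (le_max_right _ _)
      have h1 : ‖z‖ * ‖D z‖ ≤ 3 + ‖z‖ := by
        have h2 : z * D z = F z - 1 := by rw [hFD]; ring
        rw [← norm_mul, h2]
        refine (norm_sub_le _ _).trans ?_
        rw [norm_one]
        linarith [hlin z]
      have h3 : 0 < ‖z‖ := one_pos.trans_le hz
      refine le_of_mul_le_mul_left ?_ h3
      linarith
  set c := D 0 with hc
  have hFc : ∀ z, F z = 1 + z * c := fun z => by
    rw [hFD, hDd.apply_eq_apply_of_bounded hbdd z 0]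
  -- At `iy` the hypothesis gives `|F(iy)| ≤ 1`, which an affine function with nonzero slope
  -- violates for large `y`.
  have hcy : ∀ y : ℝ, 0 < y → y * ‖c‖ ≤ 2 := by
    intro y hy
    have h1 := hb (y * I) (by simpa using hy)
    rw [im_ofReal_mul, I_im, mul_one, norm_mul, norm_real, norm_I, mul_one,
      Real.norm_of_nonneg hy.le] at h1
    have h2 : ‖F (y * I)‖ ≤ 1 := by
      refine le_of_mul_le_mul_right ?_ hy
      linarith
    have h3 : (y : ℂ) * I * c = F (y * I) - 1 := by rw [hFc]; ring
    calc y * ‖c‖ = ‖(y : ℂ) * I * c‖ := by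
          rw [norm_mul, norm_mul, norm_real, norm_I, mul_one, Real.norm_of_nonneg hy.le]
      _ ≤ ‖F (y * I)‖ + ‖(1 : ℂ)‖ := by rw [h3]; exact norm_sub_le _ _
      _ ≤ 2 := by rw [norm_one]; linarith
  have hc0 : c = 0 := by
    by_contra hne
    have h1 : 0 < ‖c‖ := norm_pos_iff.2 hne
    have h2 := hcy (3 / ‖c‖) (by positivity)
    rw [div_mul_cancel₀ _ h1.ne'] at h2
    linarith
  rw [hFc, hc0, mul_zero, add_zero]

/-- A limit of products of Herglotz pairs that vanishes at all zeros of the canonical product is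
this canonical product. -/
theorem tendstoLocallyUniformly_canonicalProduct {ι κ : Type*} {a : ι → ℂ}
    (ha : Summable fun i => ‖a i‖) (hreal : ∀ i, (a i).im = 0) (ha0 : ∀ i, a i ≠ 0)
    (hinj : Function.Injective a) {l : Filter κ} {φ ψ : κ → ℂ → ℂ}
    (h : ∀ k, IsHerglotzPair a (φ k) (ψ k))
    (hzero : ∀ i, Tendsto (fun k => φ k (a i)⁻¹ * ψ k (a i)⁻¹) l (𝓝 0)) :
    TendstoLocallyUniformly (fun k z => φ k z * ψ k z) (canonicalProduct a) l := by
  rw [tendstoLocallyUniformly_iff_forall_isCompact]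
  intro K hK u hu
  -- Working along ultrafilters replaces passing to subsequences: it suffices to identify the limit
  -- along each ultrafilter finer than `l`.
  refine mem_iff_ultrafilter.2 fun U hU => ?_
  have hsub : ∀ ε : ℝ, 0 < ε → ∃ C : ℝ, ∀ k z, ‖φ k z * ψ k z‖ ≤ C * Real.exp (ε * ‖z‖) := by
    intro ε hε
    obtain ⟨C, hC0, hC⟩ := IsHerglotzPair.exists_uniform_bound ha hreal (half_pos hε)
    refine ⟨C * C, fun k z => ?_⟩
    rw [norm_mul]
    calc ‖φ k z‖ * ‖ψ k z‖ ≤ (C * Real.exp (ε / 2 * ‖z‖)) * (C * Real.exp (ε / 2 * ‖z‖)) := by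
          gcongr
          exacts [hC _ _ (h k) z, hC _ _ (h k).symm z]
      _ = C * C * (Real.exp (ε / 2 * ‖z‖) * Real.exp (ε / 2 * ‖z‖)) := by ring
      _ = C * C * Real.exp (ε * ‖z‖) := by rw [← Real.exp_add]; ring_nf
  obtain ⟨g, hg, hlim⟩ := exists_tendstoLocallyUniformly_ultrafilter U
    (F := fun k z => φ k z * ψ k z) (fun k => (h k).diff_left.mul (h k).diff_right) (fun R => by
      obtain ⟨C, hC⟩ := hsub 1 one_pos
      refine ⟨|C| * Real.exp (1 * R), fun k z hz => (hC k z).trans ?_⟩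
      gcongr
      exact le_abs_self C)
  have hpt : ∀ z, Tendsto (fun k => φ k z * ψ k z) U (𝓝 (g z)) := fun z =>
    (tendstoLocallyUniformlyOn_univ.2 hlim).tendsto_at (mem_univ z)
  have hgs : SubexpOn univ g := fun ε hε => (hsub ε hε).imp fun C hC z _ =>
    le_of_tendsto (hpt z).norm (Eventually.of_forall fun k => hC k z)
  have hg0 : g 0 = 1 := tendsto_nhds_unique (hpt 0)
    (tendsto_const_nhds.congr fun k => by rw [(h k).left_zero, (h k).right_zero, one_mul])
  obtain ⟨F, hF, hFO, hgF⟩ := exists_eq_mul_canonicalProduct ha ha0 hinj hg hgs fun i =>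
    tendsto_nhds_unique (hpt _) ((hzero i).mono_left hU)
  have hF1 : ∀ z, F z = 1 := by
    refine eq_one_of_norm_mul_im_le hF hFO ?_ (fun z hz => ?_) ?_
    · refine hgs.mono (subset_univ _) fun z hz => ?_
      have h1 : z = (z.im : ℂ) * I := Complex.ext (by simp [hz.2]) (by simp)
      rw [hgF, norm_mul]
      refine le_mul_of_one_le_right (norm_nonneg _) ?_
      rw [h1]
      exact one_le_norm_canonicalProduct_mul_I ha hreal _
    · have hE : 0 < ‖canonicalProduct a z‖ :=
        norm_pos_iff.2 (canonicalProduct_ne_zero_of_im_ne_zero ha hreal hz.ne')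
      have hz0 : 0 < ‖z‖ := hz.trans_le ((le_abs_self _).trans (abs_im_le_norm z))
      -- Julia's bound for each pair, with a factor `|z|` cancelled, passes to the limit.
      have h1 : ‖g z‖ * z.im ≤ ‖z‖ * ‖canonicalProduct a z‖ := by
        refine le_of_tendsto ((hpt z).norm.mul_const z.im) (Eventually.of_forall fun k => ?_)
        have h2 := (h k).norm_mul_im_le ha hreal hz
        rw [norm_div, div_mul_eq_mul_div, div_le_iff₀ hE, mul_assoc, norm_mul] at h2
        refine le_of_mul_le_mul_left ?_ hz0
        linarith
      rw [hgF, norm_mul] at h1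
      refine le_of_mul_le_mul_right ?_ hE
      linarith
    · have h1 := hgF 0
      rw [hg0, canonicalProduct_zero, mul_one] at h1
      exact h1.symm
  have hgE : g = canonicalProduct a := funext fun z => by rw [hgF, hF1, one_mul]
  rw [hgE, tendstoLocallyUniformly_iff_forall_isCompact] at hlim
  exact hlim K hK u hu

/-! ### The coupling problem -/

theorem exists_of_lt_absLogAbs {c : OnePoint ℝ} {L : ℝ} (h : ENNReal.ofReal L < absLogAbs c) :
    c = OnePoint.infty ∨ ∃ r : ℝ, c = (r : OnePoint ℝ) ∧
      (|r| ≤ Real.exp (-L) ∨ Real.exp L ≤ |r|) := by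
  induction c using OnePoint.rec with
  | infty => exact Or.inl rfl
  | coe r =>
    refine Or.inr ⟨r, rfl, ?_⟩
    rcases eq_or_ne r 0 with rfl | hr
    · left
      simpa using (Real.exp_pos _).le
    · have hr0 : 0 < |r| := abs_pos.2 hr
      have h1 : absLogAbs (r : OnePoint ℝ) = ENNReal.ofReal |Real.log (|r|)| := by
        change (ENNReal.log (ENNReal.ofReal |r|)).abs = _
        rw [ENNReal.log_ofReal_of_pos hr0]
        rfl
      rw [h1] at h
      have h2 : L < |Real.log (|r|)| := (ENNReal.ofReal_lt_ofReal_iff'.1 h).1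
      rcases lt_abs.1 h2 with h3 | h3
      · right
        exact (Real.le_log_iff_exp_le hr0).1 h3.le
      · left
        exact (Real.log_le_iff_le_exp hr0).1 (by linarith)

/-- A small coupling constant makes `Φ₊` small at `s`, and a large or infinite one makes `Φ₋` small;
the other factor is at most `B`. -/
theorem IsSolution.norm_mul_le {σ : Set ℝ} {η : σ → OnePoint ℝ} {Φm Φp : ℂ → ℂ}
    (h : IsSolution σ η Φm Φp) {s : σ} {B L : ℝ} (hm : ‖Φm ((s : ℝ) : ℂ)‖ ≤ B)
    (hp : ‖Φp ((s : ℝ) : ℂ)‖ ≤ B) (hL : ENNReal.ofReal L < absLogAbs (η s)) :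
    ‖Φm ((s : ℝ) : ℂ) * Φp ((s : ℝ) : ℂ)‖ ≤ Real.exp (-L) * B ^ 2 := by
  have hB : 0 ≤ B := (norm_nonneg _).trans hm
  rcases exists_of_lt_absLogAbs hL with h1 | ⟨c, hc, h1 | h1⟩
  · rw [h.coupling_infty s h1, zero_mul, norm_zero]
    positivity
  · rw [h.coupling s c hc, norm_mul, norm_mul, norm_real, Real.norm_eq_abs]
    calc ‖Φm ((s : ℝ) : ℂ)‖ * (|c| * ‖Φm ((s : ℝ) : ℂ)‖) ≤ B * (Real.exp (-L) * B) := by gcongr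
      _ = _ := by ring
  · have h2 := h.coupling s c hc
    have hm' : ‖Φm ((s : ℝ) : ℂ)‖ ≤ Real.exp (-L) * B := by
      rw [h2, norm_mul, norm_real, Real.norm_eq_abs] at hp
      rw [Real.exp_neg, inv_mul_eq_div, le_div_iff₀ (Real.exp_pos _), mul_comm]
      refine le_trans ?_ hp
      gcongr
    rw [norm_mul]
    calc ‖Φm ((s : ℝ) : ℂ)‖ * ‖Φp ((s : ℝ) : ℂ)‖ ≤ (Real.exp (-L) * B) * B := by gcongr
      _ = _ := by ring

theorem W_eq_canonicalProduct (σ : Set ℝ) :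
    W σ = canonicalProduct fun s : σ => ((s : ℝ) : ℂ)⁻¹ := by
  funext z
  simp only [W, canonicalProduct, div_eq_inv_mul]

theorem IsEntireOfTypeZero.subexpOn {f : ℂ → ℂ} (hf : IsEntireOfTypeZero f) :
    SubexpOn univ f := fun ε hε => (hf.2 ε hε).imp fun _ hC z _ => hC z

theorem IsSolution.isHerglotzPair {σ : Set ℝ} {η : σ → OnePoint ℝ} {Φm Φp : ℂ → ℂ}
    (h : IsSolution σ η Φm Φp) :
    IsHerglotzPair (fun s : σ => ((s : ℝ) : ℂ)⁻¹) Φm Φp where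
  diff_left := h.entire_m.1
  diff_right := h.entire_p.1
  subexp_left := h.entire_m.subexpOn
  subexp_right := h.entire_p.subexpOn
  left_zero := h.normalization_m
  right_zero := h.normalization_p
  nonneg := by
    rw [← W_eq_canonicalProduct]
    exact h.positivity

theorem tendstoLocallyUniformlyOn_div_of_tendstoLocallyUniformly {κ : Type*} {l : Filter κ}
    {P : κ → ℂ → ℂ} {V : ℂ → ℂ} (hV : Continuous V) (h : TendstoLocallyUniformly P V l) :
    TendstoLocallyUniformlyOn (fun k z => P k z / V z) (fun _ => 1) l {z | V z ≠ 0} := by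
  rw [tendstoLocallyUniformlyOn_iff_forall_isCompact (isOpen_ne_fun hV continuous_const)]
  intro K hKV hK
  rw [Metric.tendstoUniformlyOn_iff]
  intro ε hε
  rcases K.eq_empty_or_nonempty with rfl | hne
  · simp
  -- On a compact set avoiding the zeros, `|V|` has a positive minimum, so division preserves
  -- uniform convergence.
  obtain ⟨z₀, hz₀, hmin⟩ := hK.exists_isMinOn hne hV.norm.continuousOn
  have hc : 0 < ‖V z₀‖ := norm_pos_iff.2 (hKV hz₀)
  have h1 := Metric.tendstoUniformlyOn_iff.1
    (tendstoLocallyUniformly_iff_forall_isCompact.1 h K hK) (ε * ‖V z₀‖) (by positivity)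
  filter_upwards [h1] with k hk z hz
  have h2 := hk z hz
  have h3 : ‖V z₀‖ ≤ ‖V z‖ := hmin hz
  have h4 : V z ≠ 0 := hKV hz
  rw [dist_eq_norm] at h2 ⊢
  have h5 : 1 - P k z / V z = (V z - P k z) / V z := by field_simp
  rw [h5, norm_div, div_lt_iff₀ (hc.trans_le h3)]
  refine h2.trans_le ?_
  gcongr

end EntireCoupling

theorem mainTheorem3
    (σ : Set ℝ) (hσ0 : (0 : ℝ) ∉ σ) (hσ : Summable fun s : σ => 1 / |(s : ℝ)|)
    {Δ : Type*} [TopologicalSpace Δ] [FirstCountableTopology Δ] (δinf : Δ)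
    (η : Δ → σ → OnePoint ℝ)
    (hη : ∀ s : σ, Tendsto (fun δ => EntireCoupling.absLogAbs (η δ s)) (𝓝[≠] δinf) (𝓝 ⊤))
    (Φm Φp : Δ → ℂ → ℂ)
    (hΦ : ∀ δ : Δ, EntireCoupling.IsSolution σ (η δ) (Φm δ) (Φp δ)) :
    TendstoLocallyUniformlyOn
      (fun (δ : Δ) (z : ℂ) => Φm δ z * Φp δ z / EntireCoupling.W σ z) (fun _ => 1)
      (𝓝[≠] δinf) ((fun x : ℝ => (x : ℂ)) '' σ)ᶜ := by
  set a : σ → ℂ := fun s => ((s : ℝ) : ℂ)⁻¹ with ha_def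
  have hs0 : ∀ s : σ, ((s : ℝ) : ℂ) ≠ 0 := fun s h =>
    hσ0 (by simpa [Complex.ofReal_eq_zero.1 h] using s.2)
  have ha : Summable fun s => ‖a s‖ := by simpa [ha_def] using hσ
  have hreal : ∀ s, (a s).im = 0 := fun s => by
    rw [ha_def]
    beta_reduce
    rw [← Complex.ofReal_inv, Complex.ofReal_im]
  have hinj : Function.Injective a := fun s t hst =>
    Subtype.ext (Complex.ofReal_injective (inv_injective hst))
  have hpair : ∀ δ, EntireCoupling.IsHerglotzPair a (Φm δ) (Φp δ) := fun δ => (hΦ δ).isHerglotzPair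
  have hzero : ∀ s, Tendsto (fun δ => Φm δ (a s)⁻¹ * Φp δ (a s)⁻¹) (𝓝[≠] δinf) (𝓝 0) := by
    intro s
    -- Here the uniformity matters: `C`, and hence the bound `B` at `s`, does not depend on `δ`, so
    -- `L` can be chosen before `δ`.
    obtain ⟨C, hC0, hC⟩ := EntireCoupling.IsHerglotzPair.exists_uniform_bound ha hreal one_pos
    set B := C * Real.exp (1 * ‖((s : ℝ) : ℂ)‖) with hB
    rw [Metric.tendsto_nhds]
    intro ε hε
    have hlim : Tendsto (fun L : ℝ => Real.exp (-L) * B ^ 2) atTop (𝓝 0) := by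
      simpa using (Real.tendsto_exp_neg_atTop_nhds_zero).mul_const (B ^ 2)
    obtain ⟨L, hL⟩ := (hlim.eventually (gt_mem_nhds hε)).exists
    filter_upwards [(hη s).eventually (lt_mem_nhds ENNReal.ofReal_lt_top)] with δ hδ
    rw [dist_zero_right, ha_def, inv_inv]
    exact ((hΦ δ).norm_mul_le (hC _ _ (hpair δ) _) (hC _ _ (hpair δ).symm _) hδ).trans_lt hL
  have hlim := EntireCoupling.tendstoLocallyUniformly_canonicalProduct ha hreal (fun s => inv_ne_zero (hs0 s))
    hinj hpair hzero
  rw [EntireCoupling.W_eq_canonicalProduct]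
  refine (EntireCoupling.tendstoLocallyUniformlyOn_div_of_tendstoLocallyUniformly
    (EntireCoupling.differentiable_canonicalProduct ha).continuous hlim).mono fun z hz => ?_
  refine EntireCoupling.canonicalProduct_ne_zero ha fun s h => hz ⟨s, s.2, ?_⟩
  have h1 : ((s : ℝ) : ℂ)⁻¹ * z = 1 := (sub_eq_zero.1 h).symm
  exact ((inv_mul_eq_one₀ (hs0 s)).1 h1)
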